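/- \textbf{Conventions.} A square is identified with its centre; boards of odd side are centred at the origin of $\mathbb Z^2$. A $(p,q)$-leaper moves by vectors $(\pm p,\pm q)$, $(\pm q,\pm p)$; it is skew basic, with $p<q$, if $0<p<q$, $\gcd(p,q)=1$ and $p+q$ is odd. The direction matrices are $$A_1=\begin{pmatrix}0&1\\1&0\end{pmatrix},\ A_2=\begin{pmatrix}1&0\\0&1\end{pmatrix},\ A_3=\begin{pmatrix}-1&0\\0&1\end{pmatrix},\ A_4=\begin{pmatrix}0&-1\\1&0\end{pmatrix},\ A_{i+4}=-A_i\ (i=1,\dots,4),$$ and a move of direction $i$ of a $(p,q)$-leaper with $p<q$ is the move by the vector $A_i\binom pq$. \textbf{Direction graphs.} A direction graph is a symmetric directed graph with arcs labelled by $1,\dots,8$ such that the sum of the direction matrices of the labels over every simple directed cycle (also of length $1$ or $2$) is zero. The distance from $x$ to $y$ in the same component is the sum of the direction matrices over any path from $x$ to $y$. The graph is coherent if, for all $x,y$ in the same component, the distance is $0$ iff $x=y$ and is a direction matrix iff $x$ and $y$ are joined by an arc. A direction graph $\Phi$ is \emph{dual}, of complement $\Phi'$ (a direction graph) and duality matrix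 $A\in\mathbb R^{2\times2}$, if $A$ is not a direction matrix, $\Phi$ and $\Phi'$ are coherent and connected, their underlying unlabelled graphs are isomorphic, and there is a bijection $\eta$ from the vertices of $\Phi$ to those of $\Phi'$ such that for every arc from $\eta(a)$ to $\eta(b)$ labelled $i$ in $\Phi'$ the distance from $a$ to $b$ in $\Phi$ is $A_iA$. The labelled graph extracted from a cycle of a skew leaper has the squares of the cycle as its vertices (up to a bijection), and an arc labelled $i$ from $a$ to $b$ iff $a,b$ are adjacent in the cycle and the move from $a$ to $b$ has direction $i$. \textbf{Frames and liftings.} For $m<n$ with $m+n$ odd, the $(m,n)$-frame is the centred $(m+n)\times(m+n)$ board without its central $(n-m)\times(n-m)$ squares; extending the sides of the hole divides it into eight sections $F_E,F_{NE},F_N,\dots,F_{SE}$. If $3m\ge n$, its shell is the union of eight square subboards, one in each section: of side $n-m$ if $2m\ge n$, and of side $3m-n$ if $2m\le n\le 3m$, with those of $F_E$ and $F_{NE}$ centred at $(n-m,0)$ and $(m,m)$ and the others placed symmetrically under quarter turns. A shell cycle is a cycle of the $(m,n)$-leaper within the shell; it has one square in each section. The liftings $f,g,h$ lift an $(m,n)$-frame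 $F$ to the frame $H$ of proportions $(m,2m+n)$, $(n,2n-m)$, $(n,m+2n)$, respectively. Their translations are given by $v_E=(m+n,0),\ v_{NE}=(m,m)$ for $f$; $v_E=(n-m,0),\ v_{NE}=(n,n)$ for $g$; $v_E=(m+n,0),\ v_{NE}=(n,n)$ for $h$; and $v_N,\dots,v_{SE}$ by quarter turns. A set $S$ of squares of $F$ is lifted to $\bigcup_i\,(S+v_i)\cap H_i$. A cycle $a^Ea^{NE}\cdots a^{SE}$, partitioned into eight paths with $a^i$ in $F_i$, is lifted to $b^Eb^{NE}\cdots b^{SE}$, where (writing $-w$ for the reversal of a path $w$) $$\begin{aligned} f:\quad& b^E=(-a^{SW})(-a^W)(-a^{NW})+v_E,\quad b^{NE}=a^{NE}+v_{NE};\\ g:\quad& b^E=a^E+v_E,\quad b^{NE}=(-a^S)(-a^{SW})(-a^W)+v_{NE};\\ h:\quad& b^E=(-a^S)(-a^{SW})(-a^W)(-a^{NW})(-a^N)+v_E,\quad b^{NE}=a^Ea^{NE}a^N+v_{NE}; \end{aligned}$$ and the other $b^i$ are defined likewise by quarter turns. For a string $e=e_1\cdots e_l$ over $\{f,g,h\}$,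 applying $e$ means applying the liftings $e_l,e_{l-1},\dots,e_1$ in this order. A skew basic $(p,q)$-leaper, $p<q$, has descent $d$ if $d$ lifts a $(1,2)$-frame to a $(p,q)$-frame. \textbf{Fundamental direction cycles.} Let the skew basic $(p,q)$-leaper $L$, $p<q$, have descent $ed$ (the concatenation of $e$ and $d$), and let $C$ be a cycle of $L$ within the $(p+q)\times(p+q)$ board. If the vertex set of $C$ is obtained by applying $e$ to the vertex set of a shell cycle of the frame of descent $d$, then $C$ has descent $e$. The \emph{fundamental direction cycle} $\Phi(e)$ is the labelled graph extracted from a cycle of descent $e$. If moreover $d=od'$ with $o\in\{g,h\}$, let $M$ be the skew basic leaper of descent $d'$; visiting the squares of the shell cycle in the order $E,NE,\dots,SE$ of the sections gives an eight-square cycle of $M$, and lifting this partitioned cycle by $e$ gives a cycle $D$ of $M$ over the squares of $C$, the canonical second leaper cycle of descent $e$ and origin $o$. The \emph{second fundamental direction cycle} $\Phi^{\mathrm{II}}_o(e)$ is the labelled graph extracted from a canonical second leaper cycle of descent $e$ and origin $o$. Let $A_f=\begin{pmatrix}1&0\\2&1\end{pmatrix}$, $A_g=\begin{pmatrix}0&1\\-1&2\end{pmatrix}$,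 $A_h=\begin{pmatrix}0&1\\1&2\end{pmatrix}$ and $A_e=A_{e_1}A_{e_2}\cdots A_{e_l}$ (the identity matrix if $e$ is empty). \textbf{Theorem.} Let $e$ be a (possibly empty) string composed of the characters $f,g,h$, and let $o\in\{g,h\}$. Then cycles of descent $e$, and canonical second leaper cycles of descent $e$ and origin $o$, exist, and for every choice of the cycles from which $\Phi(e)$ and $\Phi^{\mathrm{II}}_o(e)$ are extracted, both $\Phi(e)$ and $\Phi^{\mathrm{II}}_o(e)$ are dual direction graphs. Each of them is a complement of the other, the duality matrix of $\Phi^{\mathrm{II}}_o(e)$ being $A_eA_o$ and that of $\Phi(e)$ being $(A_eA_o)^{-1}$. -/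

import Mathlib

/-- A square of the infinite chessboard, named by its centre. The boards below are
`(p + q) × (p + q)` boards with `p + q` odd; they are centred at the origin, so that the centres
of their squares are integer points. -/
abbrev Square : Type := ℤ × ℤ

/-- The direction matrices `A_1, …, A_8`. The index `i : Fin 8` stands for the skew direction
labelled `i + 1` (`0` is east-northeast, `1` is north-northeast, and so on counterclockwise). -/
def dirMatrix : Fin 8 → Matrix (Fin 2) (Fin 2) ℤ :=
  ![!![0, 1; 1, 0], !![1, 0; 0, 1], !![-1, 0; 0, 1], !![0, -1; 1, 0],
    !![0, -1; -1, 0], !![-1, 0; 0, -1], !![1, 0; 0, -1], !![0, 1; -1, 0]]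

/-- Integer matrices regarded as real matrices. -/
def realMatrix (A : Matrix (Fin 2) (Fin 2) ℤ) : Matrix (Fin 2) (Fin 2) ℝ :=
  A.map (fun z : ℤ => (z : ℝ))

/-! ### Direction graphs -/

/-- A directed graph with vertex set `V` whose arcs are labelled with skew directions:
`Φ.Arc x y i` says that an arc labelled `i` points from `x` to `y`. -/
structure LabeledDigraph (V : Type*) where
  Arc : V → V → Fin 8 → Prop

namespace LabeledDigraph

/-- There is an arc, with some label, from `x` to `y`. -/
def Adj {V : Type*} (Φ : LabeledDigraph V) (x y : V) : Prop := ∃ i, Φ.Arc x y i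

/-- `Φ.Walk x y l A`: there is a directed walk from `x` to `y` which, after its start `x`, visits
the vertices of the list `l` in this order, and on which the direction matrices of the arcs
sum to `A`. -/
inductive Walk {V : Type*} (Φ : LabeledDigraph V) :
    V → V → List V → Matrix (Fin 2) (Fin 2) ℤ → Prop
  | nil (x : V) : Walk Φ x x [] 0
  | cons (x y z : V) (i : Fin 8) (l : List V) (A : Matrix (Fin 2) (Fin 2) ℤ) :
      Φ.Arc x y i → Walk Φ y z l A → Walk Φ x z (y :: l) (dirMatrix i + A)

/-- A direction graph: the directed graph is symmetric, and the direction matrices over every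
simple directed cycle (loops and the 2-cycles `x → y → x` included) sum to zero. So there are
in fact no loops, an arc has only one label, and opposite arcs have opposite labels. -/
def IsDirectionGraph {V : Type*} (Φ : LabeledDigraph V) : Prop :=
  (∀ x y, Φ.Adj x y → Φ.Adj y x) ∧
  ∀ (x : V) (l : List V) (A : Matrix (Fin 2) (Fin 2) ℤ),
    l ≠ [] → l.Nodup → Φ.Walk x x l A → A = 0

/-- `A` is the distance from `x` to `y`: the sum of the direction matrices over a walk from `x`
to `y`. In a direction graph this does not depend on the walk. -/
def HasDist {V : Type*} (Φ : LabeledDigraph V) (x y : V) (A : Matrix (Fin 2) (Fin 2) ℤ) : Prop :=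
  ∃ l, Φ.Walk x y l A

/-- Connectedness (of a symmetric directed graph). -/
def IsConnected {V : Type*} (Φ : LabeledDigraph V) : Prop :=
  Nonempty V ∧ ∀ x y, ∃ A, Φ.HasDist x y A

/-- Coherence: for `x` and `y` in the same component, the distance from `x` to `y` is zero
exactly if `x = y`, and a direction matrix exactly if `x` and `y` are joined by an arc. -/
def IsCoherent {V : Type*} (Φ : LabeledDigraph V) : Prop :=
  ∀ x y A, Φ.HasDist x y A → (A = 0 ↔ x = y) ∧ ((∃ i, A = dirMatrix i) ↔ Φ.Adj x y)

/-- `Φ` is a dual direction graph of complement `Φ'` and duality matrix `M`. -/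
def IsDualWith {V V' : Type*} (Φ : LabeledDigraph V) (Φ' : LabeledDigraph V')
    (M : Matrix (Fin 2) (Fin 2) ℝ) : Prop :=
  Φ.IsDirectionGraph ∧ Φ'.IsDirectionGraph ∧
  (∀ i, M ≠ realMatrix (dirMatrix i)) ∧
  (Φ.IsCoherent ∧ Φ.IsConnected) ∧ (Φ'.IsCoherent ∧ Φ'.IsConnected) ∧
  (∃ φ : V ≃ V', ∀ x y, Φ.Adj x y ↔ Φ'.Adj (φ x) (φ y)) ∧
  ∃ η : V ≃ V', ∀ a b i, Φ'.Arc (η a) (η b) i →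
    ∃ A, Φ.HasDist a b A ∧ realMatrix A = realMatrix (dirMatrix i) * M

/-- `Φ` is a dual direction graph. -/
def IsDual.{u} {V : Type u} (Φ : LabeledDigraph V) : Prop :=
  ∃ (V' : Type u) (Φ' : LabeledDigraph V') (M : Matrix (Fin 2) (Fin 2) ℝ), Φ.IsDualWith Φ' M

end LabeledDigraph

/-! ### Leapers and their cycles -/

/-- A `(p, q)`-leaper with `p < q` that is skew and basic. -/
def IsSkewBasic (p q : ℤ) : Prop := 0 < p ∧ p < q ∧ Odd (p + q) ∧ IsCoprime p q

/-- A move of direction `i` of a `(p, q)`-leaper leads from `a` to `b`. -/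
def MoveDir (p q : ℤ) (i : Fin 8) (a b : Square) : Prop :=
  ![b.1 - a.1, b.2 - a.2] = (dirMatrix i).mulVec ![p, q]

/-- `b` follows `a` in the cyclic sequence `l`. -/
def Follows (l : List Square) (a b : Square) : Prop := ∃ t, l ~r (a :: b :: t)

/-- The cyclic sequence `l` is a (simple) cycle of a `(p, q)`-leaper. -/
def IsLeaperCycle (p q : ℤ) (l : List Square) : Prop :=
  l.Nodup ∧ 3 ≤ l.length ∧ ∀ a b, Follows l a b → ∃ i, MoveDir p q i a b

/-- The vertex set of a cycle. -/
def vertexSet (l : List Square) : Set Square := {a | a ∈ l}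

/-- The labelled directed graph `Φ` is extracted from the cycle `l` of a `(p, q)`-leaper: for a
suitable bijection `σ` of the vertices, an arc labelled `i` points from `σ a` to `σ b` if and only
if `a` and `b` are adjacent in the cycle and the move from `a` to `b` has direction `i`. -/
def IsExtractedFrom {V : Type*} (Φ : LabeledDigraph V) (p q : ℤ) (l : List Square) : Prop :=
  ∃ σ : {a // a ∈ l} ≃ V, ∀ (a b : {a // a ∈ l}) (i : Fin 8),
    Φ.Arc (σ a) (σ b) i ↔
      (Follows l a.1 b.1 ∨ Follows l b.1 a.1) ∧ MoveDir p q i a.1 b.1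

/-! ### Frames, shells and liftings -/

/-- The `(p + q) × (p + q)` chessboard. -/
def board (p q : ℤ) : Set Square := {a | 2 * |a.1| < p + q ∧ 2 * |a.2| < p + q}

/-- Eight vectors pointing east, northeast, …, southeast (indices `0, 1, …, 7`), where the side
directions have length `a` and the corner directions have both coordinates `± b`. -/
def octVec (a b : ℤ) : Fin 8 → ℤ × ℤ :=
  ![(a, 0), (b, b), (0, a), (-b, b), (-a, 0), (-b, -b), (0, -a), (b, -b)]

/-- The coordinate `x` of a square of an `(m, n)`-frame is level with the central hole (`s = 0`)
or between the hole and the outer contour, on the side of sign `s` (`s = 1` or `s = -1`). -/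
def InBand (m n s x : ℤ) : Prop :=
  if s = 0 then 2 * |x| < n - m else n - m < 2 * (s * x) ∧ 2 * (s * x) < m + n

/-- The section of the `(m, n)`-frame in the direction `i` (east, northeast, …, southeast).
The frame is the disjoint union of its eight sections. -/
def frameSection (m n : ℤ) (i : Fin 8) : Set Square :=
  {a | InBand m n (octVec 1 1 i).1 a.1 ∧ InBand m n (octVec 1 1 i).2 a.2}

/-- The shell of the `(m, n)`-frame, `n ≤ 3 * m`. If `n ≤ 2 * m`, it consists of the eight
subboards of side `n - m` in the corners and next to the sides of the hole. If
`2 * m ≤ n ≤ 3 * m`, it consists of the eight subboards of side `3 * m - n` in the middle of the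
outer sides and touching the hole at its corners. In both cases the subboards of the east and the
northeast sections are centred at `(n - m, 0)` and `(m, m)`. (If `3 * m < n`, there is no shell,
and this is the empty set.) -/
def shell (m n : ℤ) : Set Square :=
  {a | ∃ i : Fin 8,
    2 * |a.1 - (octVec (n - m) m i).1| < (if n ≤ 2 * m then n - m else 3 * m - n) ∧
    2 * |a.2 - (octVec (n - m) m i).2| < (if n ≤ 2 * m then n - m else 3 * m - n)}

/-- A shell cycle of the `(m, n)`-frame: a cycle of the `(m, n)`-leaper within the shell. -/
def IsShellCycle (m n : ℤ) (C : List Square) : Prop :=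
  IsLeaperCycle m n C ∧ vertexSet C ⊆ shell m n

/-- The three types of lifting transformations. -/
inductive Lifting : Type
  | f
  | g
  | h

namespace Lifting

/-- An `(m, n)`-frame is lifted to an `(m, 2m + n)`-, `(n, 2n - m)`- or `(n, m + 2n)`-frame. -/
def frame : Lifting → ℤ × ℤ → ℤ × ℤ
  | f, (m, n) => (m, 2 * m + n)
  | g, (m, n) => (n, 2 * n - m)
  | h, (m, n) => (n, m + 2 * n)

/-- The `f`-, `g`- or `h`-translation of an `(m, n)`-frame in the direction `i`. -/
def translation : Lifting → ℤ × ℤ → Fin 8 → ℤ × ℤ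
  | f, (m, n) => octVec (m + n) m
  | g, (m, n) => octVec (n - m) n
  | h, (m, n) => octVec (m + n) n

/-- The lift of a set `S` of squares of the frame `F = (m, n)`: the union over all directions `i`
of the sets `(S + v_i) ∩ H_i`, where `H` is the lifted frame. -/
def liftSet (c : Lifting) (F : ℤ × ℤ) (S : Set Square) : Set Square :=
  {b | ∃ i : Fin 8, b ∈ frameSection (c.frame F).1 (c.frame F).2 i ∧ b - c.translation F i ∈ S}

/-- The lift of a cycle `a 0, a 1, …, a 7` (that is, `a^E, a^NE, …, a^SE`) partitioned into eight
paths, one in each section of the frame `F`. Each new path is a concatenation of old paths,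
reversed or not, translated by `v_i`:

* `f`: `b^E = -a^SW -a^W -a^NW + v_E` and `b^NE = a^NE + v_NE`,
* `g`: `b^E = a^E + v_E` and `b^NE = -a^S -a^SW -a^W + v_NE`,
* `h`: `b^E = -a^S -a^SW -a^W -a^NW -a^N + v_E` and `b^NE = a^E a^NE a^N + v_NE`,

and symmetrically under quarter turns. -/
def liftPaths (c : Lifting) (F : ℤ × ℤ) (a : Fin 8 → List Square) : Fin 8 → List Square :=
  fun i =>
    (match c, decide (i.val % 2 = 0) with
      | f, true => (a (i + 5)).reverse ++ (a (i + 4)).reverse ++ (a (i + 3)).reverse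
      | f, false => a i
      | g, true => a i
      | g, false => (a (i + 5)).reverse ++ (a (i + 4)).reverse ++ (a (i + 3)).reverse
      | h, true => (a (i + 6)).reverse ++ (a (i + 5)).reverse ++ (a (i + 4)).reverse ++
          (a (i + 3)).reverse ++ (a (i + 2)).reverse
      | h, false => a (i - 1) ++ a i ++ a (i + 1)).map (fun s => s + c.translation F i)

/-- The matrices `A_f`, `A_g`, `A_h`. -/
def matrix : Lifting → Matrix (Fin 2) (Fin 2) ℤ
  | f => !![1, 0; 2, 1]
  | g => !![0, 1; -1, 2]
  | h => !![0, 1; 1, 2]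

end Lifting

/-- The proportions of the frame obtained from a `(1, 2)`-frame by successively applying the
liftings of types `e_l, …, e_1`, where `e = e_1 … e_l`; that is, the proportions of the
skew basic leaper of descent `e`. -/
def proportions : List Lifting → ℤ × ℤ
  | [] => (1, 2)
  | c :: e => c.frame (proportions e)

/-- Starting from a set of squares of the frame of descent `d`, successively apply the liftings
of types `e_l, …, e_1`, where `e = e_1 … e_l`. -/
def liftSets (d : List Lifting) : List Lifting → Set Square → Set Square
  | [], S => S
  | c :: e, S => c.liftSet (proportions (e ++ d)) (liftSets d e S)

/-- Starting from a partitioned cycle in the frame of descent `d`, successively apply the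
liftings of types `e_l, …, e_1`, where `e = e_1 … e_l`. -/
def liftCycles (d : List Lifting) : List Lifting → (Fin 8 → List Square) → (Fin 8 → List Square)
  | [], a => a
  | c :: e, a => c.liftPaths (proportions (e ++ d)) (liftCycles d e a)

/-- The matrix `A_e = A_{e_1} ⋯ A_{e_l}`. -/
def wordMatrix (e : List Lifting) : Matrix (Fin 2) (Fin 2) ℤ := (e.map Lifting.matrix).prod

/-! ### The two fundamental direction cycles -/

/-- `C` is a cycle of a `(p, q)`-leaper within a `(p + q) × (p + q)` chessboard. -/
def IsBoardCycle (p q : ℤ) (C : List Square) : Prop :=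
  IsLeaperCycle p q C ∧ vertexSet C ⊆ board p q

/-- `e` is the descent of the cycle `C` of the skew basic `(p, q)`-leaper: it is a prefix of the
descent `e ++ d` of the leaper, and `C` is obtained from a shell cycle of the frame of descent `d`
by the liftings of `e`. -/
def HasDescent (p q : ℤ) (C : List Square) (e : List Lifting) : Prop :=
  ∃ d : List Lifting, proportions (e ++ d) = (p, q) ∧
    ∃ C₀, IsShellCycle (proportions d).1 (proportions d).2 C₀ ∧
      vertexSet C = liftSets d e (vertexSet C₀)

/-- `D` is the canonical second leaper cycle, of descent `e` and origin `o`, of an `(r, s)`-leaper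
over the squares of the cycle `C` of the skew basic `(p, q)`-leaper. Here `e ++ o :: d` is the
descent of the `(p, q)`-leaper and `d` that of the `(r, s)`-leaper. One starts from a shell cycle
`C₀` of the frame of descent `o :: d`, which has one square in each of the eight sections; the
second leaper visits these squares in the order of the sections; and this cycle is lifted. -/
def IsCanonicalSecondCycle (p q : ℤ) (C : List Square) (r s : ℤ) (D : List Square)
    (e : List Lifting) (o : Lifting) : Prop :=
  ∃ d : List Lifting, proportions (e ++ o :: d) = (p, q) ∧ proportions d = (r, s) ∧
    ∃ (C₀ : List Square) (a₀ : Fin 8 → List Square),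
      IsShellCycle (proportions (o :: d)).1 (proportions (o :: d)).2 C₀ ∧
      (∀ i, ∃ x ∈ frameSection (proportions (o :: d)).1 (proportions (o :: d)).2 i,
        a₀ i = [x]) ∧
      vertexSet (List.ofFn a₀).flatten = vertexSet C₀ ∧
      D = (List.ofFn (liftCycles (o :: d) e a₀)).flatten ∧
      vertexSet D = vertexSet C

/-- `Φ` is the fundamental direction cycle `Φ(e)` of descent `e`: it is extracted from a cycle of
descent `e` of a skew basic `(p, q)`-leaper within a `(p + q) × (p + q)` chessboard. -/
def IsFundamentalCycle {V : Type*} (e : List Lifting) (Φ : LabeledDigraph V) : Prop :=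
  ∃ (p q : ℤ) (C : List Square), IsSkewBasic p q ∧ IsBoardCycle p q C ∧ HasDescent p q C e ∧
    IsExtractedFrom Φ p q C

/-- `Φ` is the second fundamental direction cycle of descent `e` and origin `o`: it is extracted
from a canonical second leaper cycle of descent `e` and origin `o`, over the squares of a cycle of
a skew basic `(p, q)`-leaper within a `(p + q) × (p + q)` chessboard. -/
def IsSecondFundamentalCycle {V : Type*} (e : List Lifting) (o : Lifting)
    (Φ : LabeledDigraph V) : Prop :=
  ∃ (p q : ℤ) (C : List Square) (r s : ℤ) (D : List Square),
    IsSkewBasic p q ∧ IsBoardCycle p q C ∧ IsSkewBasic r s ∧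
    IsCanonicalSecondCycle p q C r s D e o ∧ IsExtractedFrom Φ r s D

universe u

/-! Replace squares by formal squares: integer matrices `P`, with value `act P x + t`, where `x`
gives the proportions of the base frame and `t` the offset of its shell cycle. Every lifting is
linear in the proportions, so all cycles of descent `e`, for all bases and offsets, are values of
one cycle of matrices, `formalCycle e`. On it a move of the first leaper is a difference `dirMatrix
k * wordMatrix e`. A move of the second leaper is a difference `dirMatrix k * o.matrix⁻¹`; up to a
symmetry of the square, `o.matrix⁻¹` is the same matrix `secondMat` for both origins.

Suppose that an arc labelled `k` joins two vertices exactly when the difference of their matrices is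
such a move. Then distances are differences multiplied by the inverse of `wordMatrix e`,
respectively by `o.matrix`. Coherence is immediate, and the identity on matrices is the duality
bijection: the two kinds of distance differ by the right factor `wordMatrix e * o.matrix`
(`IsPositioned.isDualWith`).

What remains is that every difference of the right form is an edge of the cycle. For the first
leaper, a square of a frame has at most two moves that stay on the board
(`moveDir_frameSection_board`), and the two neighbours in the cycle use them up. The same count,
with closure under moves (`add_move_mem_formalPaths`) and connectedness (`reflTransGen_formalMove`),
yields existence of the cycle. For the second leaper, evaluation at (1, 2) turns its moves into unit
steps, and induction on `e` shows that squares of the lifted set with a common side are consecutive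
(`areAdjacent_of_isNear`). That consecutive squares do differ by such moves follows from a closed
form for the ends of the eight paths (`corner_secondMat`). -/

/-! ### Cyclic sequences -/

/-- `b` follows `a` in the cyclic sequence `l`. -/
def CycNext {α : Type*} (l : List α) (a b : α) : Prop := ∃ t, l ~r (a :: b :: t)

theorem cycNext_iff {α : Type*} {l : List α} {a b : α} :
    CycNext l a b ↔ ∃ (i : ℕ) (h : i < l.length), 2 ≤ l.length ∧ l[i] = a ∧
      l[(i + 1) % l.length]'(Nat.mod_lt _ (by omega)) = b := by
  constructor
  · rintro ⟨t, n, hn⟩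
    have hlen : l.length = t.length + 2 := by
      rw [← List.length_rotate l n, hn]; simp
    refine ⟨n % l.length, Nat.mod_lt _ (by omega), by omega, ?_, ?_⟩
    · have h : (l.rotate n)[0]'(by simp; omega) = a := by simp [hn]
      rw [List.getElem_rotate] at h
      simpa using h
    · have h : (l.rotate n)[1]'(by simp; omega) = b := by simp [hn]
      rw [List.getElem_rotate] at h
      rw [← h]
      congr 1
      rw [Nat.mod_add_mod, add_comm]
  · rintro ⟨i, h, h2, rfl, rfl⟩
    have hlen : (l.rotate i).length = l.length := List.length_rotate l i
    match hl : l.rotate i with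
    | [] => rw [hl] at hlen; simp at hlen; omega
    | [a] => rw [hl] at hlen; simp at hlen; omega
    | a :: b :: t =>
      refine ⟨t, i, ?_⟩
      have h0 : (l.rotate i)[0]'(by omega) = a := by simp [hl]
      have h1 : (l.rotate i)[1]'(by omega) = b := by simp [hl]
      rw [List.getElem_rotate] at h0 h1
      rw [hl, ← h0, ← h1]
      congr 2
      · simp [Nat.mod_eq_of_lt h]
      · congr 1
        simp [add_comm]

theorem CycNext.mem_left {α : Type*} {l : List α} {a b : α} (h : CycNext l a b) : a ∈ l := by
  obtain ⟨i, hi, -, rfl, -⟩ := cycNext_iff.1 h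
  exact List.getElem_mem _

theorem CycNext.mem_right {α : Type*} {l : List α} {a b : α} (h : CycNext l a b) : b ∈ l := by
  obtain ⟨i, hi, -, -, rfl⟩ := cycNext_iff.1 h
  exact List.getElem_mem _

theorem CycNext.map {α β : Type*} {l : List α} {a b : α} (f : α → β) (h : CycNext l a b) :
    CycNext (l.map f) (f a) (f b) := by
  obtain ⟨t, n, hn⟩ := h
  exact ⟨t.map f, n, by rw [← List.map_rotate, hn]; rfl⟩

theorem CycNext.right_unique {α : Type*} {l : List α} (hl : l.Nodup) {a b b' : α}
    (h : CycNext l a b) (h' : CycNext l a b') : b = b' := by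
  obtain ⟨i, hi, -, rfl, rfl⟩ := cycNext_iff.1 h
  obtain ⟨j, hj, -, hij, rfl⟩ := cycNext_iff.1 h'
  obtain rfl := (hl.getElem_inj_iff).1 hij
  rfl

/-- Length at least 3 keeps predecessor and successor apart. They will exhaust the two moves
available to a leaper on the board. -/
theorem exists_cycPrev_cycNext {α : Type*} {l : List α} (hl : l.Nodup) (h3 : 3 ≤ l.length)
    {a : α} (ha : a ∈ l) : ∃ b c, CycNext l b a ∧ CycNext l a c ∧ b ≠ c := by
  obtain ⟨i, hi, rfl⟩ := List.getElem_of_mem ha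
  have hpos : 0 < l.length := by omega
  refine ⟨l[(i + (l.length - 1)) % l.length]'(Nat.mod_lt _ hpos),
    l[(i + 1) % l.length]'(Nat.mod_lt _ hpos),
    cycNext_iff.2 ⟨_, Nat.mod_lt _ hpos, by omega, rfl, ?_⟩,
    cycNext_iff.2 ⟨i, hi, by omega, rfl, rfl⟩, ?_⟩
  · congr 1
    rw [Nat.mod_add_mod, show i + (l.length - 1) + 1 = i + l.length by omega, Nat.add_mod_right,
      Nat.mod_eq_of_lt hi]
  · intro h
    have h := (hl.getElem_inj_iff).1 h
    rcases Nat.eq_zero_or_pos i with rfl | hp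
    · rw [Nat.mod_eq_of_lt (by omega), Nat.mod_eq_of_lt (by omega)] at h
      omega
    · rw [show i + (l.length - 1) = (i - 1) + l.length by omega, Nat.add_mod_right,
        Nat.mod_eq_of_lt (by omega)] at h
      rcases Nat.lt_or_ge (i + 1) l.length with h' | h'
      · rw [Nat.mod_eq_of_lt h'] at h; omega
      · rw [show i + 1 = l.length by omega, Nat.mod_self] at h; omega

theorem reflTransGen_cycNext {α : Type*} {l : List α} (h2 : 2 ≤ l.length) {a b : α}
    (ha : a ∈ l) (hb : b ∈ l) : Relation.ReflTransGen (CycNext l) a b := by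
  obtain ⟨i, hi, rfl⟩ := List.getElem_of_mem ha
  obtain ⟨j, hj, rfl⟩ := List.getElem_of_mem hb
  have hpos : 0 < l.length := by omega
  have key : ∀ k : ℕ, Relation.ReflTransGen (CycNext l) l[i]
      (l[(i + k) % l.length]'(Nat.mod_lt _ hpos)) := by
    intro k
    induction k with
    | zero => simp only [add_zero, Nat.mod_eq_of_lt hi]; exact .refl
    | succ k ih =>
      refine ih.tail (cycNext_iff.2 ⟨_, Nat.mod_lt _ hpos, h2, rfl, ?_⟩)
      congr 1
      rw [Nat.mod_add_mod, add_assoc]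
  have h := key (j + (l.length - i))
  have e : (i + (j + (l.length - i))) % l.length = j := by
    rw [show i + (j + (l.length - i)) = j + l.length by omega, Nat.add_mod_right,
      Nat.mod_eq_of_lt hj]
  simpa only [e] using h

theorem cycNext_get_iff {α : Type*} {l : List α} (hl : l.Nodup) (i j : Fin l.length) :
    CycNext l (l.get i) (l.get j) ↔ 2 ≤ l.length ∧ (i.1 + 1) % l.length = j.1 := by
  rw [cycNext_iff]
  constructor
  · rintro ⟨k, hk, h2, hki, hkj⟩
    have a1 := (hl.getElem_inj_iff).1 hki
    have a2 := (hl.getElem_inj_iff).1 hkj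
    exact ⟨h2, by rw [← a1, a2]⟩
  · rintro ⟨h2, h⟩
    exact ⟨i.1, i.2, h2, rfl, by simp [h]⟩

/-- Two cyclic sequences of the same length without repetitions are isomorphic. -/
theorem exists_equiv_cycNext {α β : Type*} {l : List α} {l' : List β} (hl : l.Nodup)
    (hl' : l'.Nodup) (h : l.length = l'.length) :
    ∃ φ : {a // a ∈ l} ≃ {b // b ∈ l'}, ∀ x y,
      CycNext l x.1 y.1 ↔ CycNext l' (φ x).1 (φ y).1 := by
  classical
  let e₁ := List.Nodup.getEquiv l hl
  let e₂ := List.Nodup.getEquiv l' hl'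
  refine ⟨e₁.symm.trans ((finCongr h).trans e₂), fun x y => ?_⟩
  obtain ⟨i, rfl⟩ := e₁.surjective x
  obtain ⟨j, rfl⟩ := e₁.surjective y
  simp only [Equiv.trans_apply, Equiv.symm_apply_apply]
  refine (cycNext_get_iff hl i j).trans
    (Iff.trans ?_ (cycNext_get_iff hl' (finCongr h i) (finCongr h j)).symm)
  simp [h]

theorem isRotated_flatten_ofFn {α : Type*} (a : Fin 8 → List α) (i : Fin 8) :
    (List.ofFn a).flatten ~r (List.ofFn fun j => a (i + j)).flatten := by
  have step : ∀ a : Fin 8 → List α,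
      (List.ofFn a).flatten ~r (List.ofFn fun j => a (1 + j)).flatten := by
    intro a
    have h1 : (List.ofFn a).flatten = a 0 ++ (a 1 ++ (a 2 ++ (a 3 ++ (a 4 ++ (a 5 ++
        (a 6 ++ a 7)))))) := by
      simp [List.ofFn_succ]
    have h2 : (List.ofFn fun j => a (1 + j)).flatten = (a 1 ++ (a 2 ++ (a 3 ++ (a 4 ++ (a 5 ++
        (a 6 ++ a 7)))))) ++ a 0 := by
      simp [List.ofFn_succ]
    rw [h1, h2]
    exact List.isRotated_append
  induction i using Fin.induction with
  | zero => simp [List.IsRotated.refl]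
  | succ i ih =>
    refine ih.trans ((step _).trans ?_)
    have : ∀ j : Fin 8, i.castSucc + (1 + j) = i.succ + j := by
      intro j
      rw [← add_assoc]
      congr 1
      simp
    simp only [this]
    exact List.IsRotated.refl _

theorem flatten_ofFn_isRotated {α : Type*} (a : Fin 8 → List α) (i : Fin 8) :
    ∃ l, (List.ofFn a).flatten ~r (a i ++ (a (i + 1) ++ l)) := by
  have hr := isRotated_flatten_ofFn a i
  generalize (List.ofFn a).flatten = L at hr ⊢
  rw [List.ofFn_succ, List.ofFn_succ, List.flatten_cons, List.flatten_cons] at hr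
  simp only [add_zero] at hr
  exact ⟨_, hr⟩

/-- A cyclic sequence which is the concatenation of eight paths: consecutive elements of one
path are consecutive. -/
theorem CycNext.flatten_of_infix {α : Type*} (a : Fin 8 → List α) (i : Fin 8) {x y : α}
    (h : [x, y] <:+: a i) : CycNext (List.ofFn a).flatten x y := by
  obtain ⟨s, t, hst⟩ := h
  obtain ⟨l, hr⟩ := flatten_ofFn_isRotated a i
  rw [← hst, List.append_assoc, List.append_assoc] at hr
  exact ⟨_, hr.trans List.isRotated_append⟩

theorem CycNext.flatten_of_junction {α : Type*} (a : Fin 8 → List α) (i : Fin 8) {x y : α}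
    (hx : x ∈ (a i).getLast?) (hy : y ∈ (a (i + 1)).head?) :
    CycNext (List.ofFn a).flatten x y := by
  obtain ⟨l, hr⟩ := flatten_ofFn_isRotated a i
  rw [← List.dropLast_append_getLast? x hx, ← List.cons_head?_tail hy, List.append_assoc] at hr
  exact ⟨_, hr.trans List.isRotated_append⟩

theorem exists_next_flatten {α : Type*} (a : Fin 8 → List α) (hne : ∀ i, a i ≠ []) {x : α}
    (hx : x ∈ (List.ofFn a).flatten) :
    (∃ i y, [x, y] <:+: a i) ∨ ∃ i, x ∈ (a i).getLast? ∧ ∃ y, y ∈ (a (i + 1)).head? := by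
  obtain ⟨l, hl, hxl⟩ := List.mem_flatten.1 hx
  obtain ⟨i, rfl⟩ := List.mem_ofFn.1 hl
  obtain ⟨s, t, hst⟩ := List.append_of_mem hxl
  match t with
  | [] =>
    right
    exact ⟨i, by simp [hst], (a (i + 1)).head (hne _), by simp [List.head?_eq_some_head (hne _)]⟩
  | y :: t =>
    left
    exact ⟨i, y, s, t, by simp [hst]⟩

/-- In a cyclic sequence without repetitions which is the concatenation of eight paths, an element
is followed by its successor on its path or by the start of the next path. -/
theorem CycNext.flatten_cases {α : Type*} {a : Fin 8 → List α} (hne : ∀ i, a i ≠ [])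
    (hnd : (List.ofFn a).flatten.Nodup) {x y : α} (h : CycNext (List.ofFn a).flatten x y) :
    (∃ i, [x, y] <:+: a i) ∨ ∃ i, x ∈ (a i).getLast? ∧ y ∈ (a (i + 1)).head? := by
  rcases exists_next_flatten a hne h.mem_left with ⟨i, z, hz⟩ | ⟨i, hx, z, hz⟩
  · obtain rfl := h.right_unique hnd (CycNext.flatten_of_infix a i hz)
    exact .inl ⟨i, hz⟩
  · obtain rfl := h.right_unique hnd (CycNext.flatten_of_junction a i hx hz)
    exact .inr ⟨i, hx, hz⟩

/-! ### Direction matrices -/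

theorem dirMatrix_add_four : ∀ i, dirMatrix (i + 4) = -dirMatrix i := by decide

/-- The direction matrices are the signed permutation matrices, a dihedral group of order eight.
Hence being a move of a leaper is invariant under the symmetries of the square. -/
theorem exists_dirMatrix_mul : ∀ i j, ∃ k, dirMatrix i * dirMatrix j = dirMatrix k := by decide

theorem exists_dirMatrix_mul_eq_one : ∀ i, ∃ j, dirMatrix i * dirMatrix j = 1 := by decide

theorem realMatrix_mul (A B : Matrix (Fin 2) (Fin 2) ℤ) :
    realMatrix (A * B) = realMatrix A * realMatrix B :=
  Matrix.map_mul (f := Int.castRingHom ℝ)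

theorem realMatrix_one : realMatrix 1 = 1 :=
  Matrix.map_one (fun z : ℤ => (z : ℝ)) Int.cast_zero Int.cast_one

theorem realMatrix_injective : Function.Injective realMatrix :=
  Matrix.map_injective Int.cast_injective

namespace LabeledDigraph

/-! ### Direction graphs given by positions of the vertices -/

/-- The vertices of `Φ` have distinct positions such that an arc labelled `i` points from `x` to
`y` exactly if the difference of their positions, multiplied by `U`, is `dirMatrix i`. -/
structure IsPositioned {V : Type*} (Φ : LabeledDigraph V)
    (pos : V → Matrix (Fin 2) (Fin 2) ℤ) (U : Matrix (Fin 2) (Fin 2) ℤ) : Prop where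
  injective : Function.Injective pos
  isUnit : ∃ U', U * U' = 1
  arc_iff : ∀ x y i, Φ.Arc x y i ↔ (pos y - pos x) * U = dirMatrix i

variable {V W : Type*} {Φ : LabeledDigraph V} {Ψ : LabeledDigraph W}
  {pos : V → Matrix (Fin 2) (Fin 2) ℤ} {pos' : W → Matrix (Fin 2) (Fin 2) ℤ}
  {U U' : Matrix (Fin 2) (Fin 2) ℤ}

/-- Differences of positions telescope along a walk, so closed walks sum to zero and distances
depend on the endpoints only. -/
theorem IsPositioned.walk_sum (h : Φ.IsPositioned pos U) {x y : V} {l : List V}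
    {A : Matrix (Fin 2) (Fin 2) ℤ} (hw : Φ.Walk x y l A) : A = (pos y - pos x) * U := by
  induction hw with
  | nil x => simp
  | cons x y z i l A ha _ ih =>
    rw [← (h.arc_iff x y i).1 ha, ih, ← Matrix.add_mul]
    congr 1
    abel

theorem IsPositioned.hasDist (h : Φ.IsPositioned pos U) {x y : V}
    {A : Matrix (Fin 2) (Fin 2) ℤ} (hw : Φ.HasDist x y A) : A = (pos y - pos x) * U :=
  let ⟨_, hl⟩ := hw
  h.walk_sum hl

theorem IsPositioned.adj_symm (h : Φ.IsPositioned pos U) {x y : V} (hxy : Φ.Adj x y) :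
    Φ.Adj y x := by
  obtain ⟨i, hi⟩ := hxy
  refine ⟨i + 4, (h.arc_iff _ _ _).2 ?_⟩
  rw [dirMatrix_add_four, ← (h.arc_iff _ _ _).1 hi, ← Matrix.neg_mul, neg_sub]

theorem IsPositioned.isDirectionGraph (h : Φ.IsPositioned pos U) : Φ.IsDirectionGraph :=
  ⟨fun _ _ => h.adj_symm, fun x l A _ _ hw => by simp [h.walk_sum hw]⟩

theorem IsPositioned.isCoherent (h : Φ.IsPositioned pos U) : Φ.IsCoherent := by
  intro x y A hA
  rw [h.hasDist hA]
  refine ⟨⟨fun h0 => ?_, fun hxy => by simp [hxy]⟩, ?_⟩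
  · obtain ⟨U', hU⟩ := h.isUnit
    have h1 : (pos y - pos x) * U * U' = 0 := by rw [h0, Matrix.zero_mul]
    rw [Matrix.mul_assoc, hU, Matrix.mul_one, sub_eq_zero] at h1
    exact (h.injective h1).symm
  · exact exists_congr fun i => (h.arc_iff x y i).symm

theorem HasDist.cons_arc {x y z : V} {A : Matrix (Fin 2) (Fin 2) ℤ} {i : Fin 8}
    (h : Φ.HasDist x y A) (hi : Φ.Arc y z i) : ∃ B, Φ.HasDist x z B := by
  obtain ⟨l, hl⟩ := h
  induction hl with
  | nil x => exact ⟨_, _, .cons _ _ _ _ _ _ hi (.nil _)⟩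
  | cons x y w j l A ha _ ih =>
    obtain ⟨B, l', hl'⟩ := ih hi
    exact ⟨_, _, .cons _ _ _ _ _ _ ha hl'⟩

theorem exists_hasDist_of_reflTransGen {x y : V} (h : Relation.ReflTransGen Φ.Adj x y) :
    ∃ A, Φ.HasDist x y A := by
  induction h with
  | refl => exact ⟨0, [], .nil _⟩
  | tail _ hyz ih =>
    obtain ⟨A, hA⟩ := ih
    obtain ⟨i, hi⟩ := hyz
    exact hA.cons_arc hi

/-- The duality bijection pairs vertices with equal positions. A difference that `U'` turns into
`dirMatrix i` is turned by `U = U' M` into `dirMatrix i * M`. -/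
theorem IsPositioned.isDualWith (h : Φ.IsPositioned pos U) (h' : Ψ.IsPositioned pos' U')
    {M : Matrix (Fin 2) (Fin 2) ℝ} (hM : realMatrix U = realMatrix U' * M)
    (hdir : ∀ i, M ≠ realMatrix (dirMatrix i)) (hΦ : Φ.IsConnected) (hΨ : Ψ.IsConnected)
    (hrange : Set.range pos = Set.range pos')
    (hiso : ∃ φ : V ≃ W, ∀ x y, Φ.Adj x y ↔ Ψ.Adj (φ x) (φ y)) : Φ.IsDualWith Ψ M := by
  refine ⟨h.isDirectionGraph, h'.isDirectionGraph, hdir, ⟨h.isCoherent, hΦ⟩,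
    ⟨h'.isCoherent, hΨ⟩, hiso, ?_⟩
  let η : V ≃ W := (Equiv.ofInjective pos h.injective).trans
    ((Equiv.setCongr hrange).trans (Equiv.ofInjective pos' h'.injective).symm)
  have hη : ∀ a, pos' (η a) = pos a := fun a => by
    simp [η, Equiv.apply_ofInjective_symm]
  refine ⟨η, fun a b i hab => ?_⟩
  obtain ⟨A, hA⟩ := hΦ.2 a b
  refine ⟨A, hA, ?_⟩
  rw [h.hasDist hA, realMatrix_mul, hM, ← (h'.arc_iff _ _ _).1 hab, hη, hη, realMatrix_mul,
    Matrix.mul_assoc]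

end LabeledDigraph

/-! ### Moves of leapers and graphs extracted from cycles -/

theorem moveDir_iff {p q : ℤ} {k : Fin 8} {a b : Square} :
    MoveDir p q k a b ↔ b.1 = a.1 + (dirMatrix k 0 0 * p + dirMatrix k 0 1 * q) ∧
      b.2 = a.2 + (dirMatrix k 1 0 * p + dirMatrix k 1 1 * q) := by
  unfold MoveDir
  rw [← List.ofFn_inj]
  simp [Matrix.mulVec, dotProduct, Fin.sum_univ_two]
  constructor <;> rintro ⟨h1, h2⟩ <;> constructor <;> linarith

theorem MoveDir.symm {p q : ℤ} {k : Fin 8} {a b : Square} (h : MoveDir p q k a b) :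
    MoveDir p q (k + 4) b a := by
  rw [moveDir_iff] at *
  rw [dirMatrix_add_four]
  simp only [Matrix.neg_apply]
  constructor <;> linarith [h.1, h.2]

theorem MoveDir.right_unique {p q : ℤ} {k : Fin 8} {a b b' : Square} (h : MoveDir p q k a b)
    (h' : MoveDir p q k a b') : b = b' := by
  rw [moveDir_iff] at *
  exact Prod.ext (h.1.trans h'.1.symm) (h.2.trans h'.2.symm)

theorem MoveDir.dir_unique {p q : ℤ} (hp : 0 < p) (hpq : p < q) {k k' : Fin 8} {a b : Square}
    (h : MoveDir p q k a b) (h' : MoveDir p q k' a b) : k = k' := by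
  rw [moveDir_iff] at *
  obtain ⟨h1, h2⟩ := h
  obtain ⟨h3, h4⟩ := h'
  rw [h1] at h3
  rw [h2] at h4
  clear h1 h2
  revert h3 h4
  fin_cases k <;> fin_cases k' <;> simp [dirMatrix] <;> omega

theorem adj_iff_of_extraction {V : Type*} {Φ : LabeledDigraph V} {p q : ℤ} {l : List Square}
    {σ : {a // a ∈ l} ≃ V} (hσ : ∀ (a b : {a // a ∈ l}) (i : Fin 8), Φ.Arc (σ a) (σ b) i ↔
      (Follows l a.1 b.1 ∨ Follows l b.1 a.1) ∧ MoveDir p q i a.1 b.1)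
    (hm : ∀ a b, Follows l a b → ∃ i, MoveDir p q i a b) (a b : {a // a ∈ l}) :
    Φ.Adj (σ a) (σ b) ↔ Follows l a.1 b.1 ∨ Follows l b.1 a.1 := by
  constructor
  · rintro ⟨i, hi⟩
    exact ((hσ a b i).1 hi).1
  · rintro (h | h)
    · obtain ⟨i, hi⟩ := hm _ _ h
      exact ⟨i, (hσ a b i).2 ⟨.inl h, hi⟩⟩
    · obtain ⟨i, hi⟩ := hm _ _ h
      exact ⟨i + 4, (hσ a b _).2 ⟨.inr h, hi.symm⟩⟩

/-- The underlying graphs of graphs extracted from two cycles of the same length are isomorphic. -/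
theorem exists_iso_of_isExtractedFrom {V W : Type*} {Φ : LabeledDigraph V} {Ψ : LabeledDigraph W}
    {p q r s : ℤ} {l l' : List Square} (hΦ : IsExtractedFrom Φ p q l)
    (hΨ : IsExtractedFrom Ψ r s l') (hl : l.Nodup) (hl' : l'.Nodup)
    (hm : ∀ a b, Follows l a b → ∃ i, MoveDir p q i a b)
    (hm' : ∀ a b, Follows l' a b → ∃ i, MoveDir r s i a b) (h : l.length = l'.length) :
    ∃ φ : V ≃ W, ∀ x y, Φ.Adj x y ↔ Ψ.Adj (φ x) (φ y) := by
  obtain ⟨σ, hσ⟩ := hΦ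
  obtain ⟨τ, hτ⟩ := hΨ
  obtain ⟨φ, hφ⟩ := exists_equiv_cycNext hl hl' h
  refine ⟨σ.symm.trans (φ.trans τ), fun x y => ?_⟩
  obtain ⟨a, rfl⟩ := σ.surjective x
  obtain ⟨b, rfl⟩ := σ.surjective y
  simp only [Equiv.trans_apply, Equiv.symm_apply_apply]
  rw [adj_iff_of_extraction hσ hm, adj_iff_of_extraction hτ hm']
  exact or_congr (hφ a b) (hφ b a)

theorem isConnected_of_isExtractedFrom {V : Type*} {Φ : LabeledDigraph V} {p q : ℤ}
    {l : List Square} (hΦ : IsExtractedFrom Φ p q l) (h2 : 2 ≤ l.length)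
    (hm : ∀ a b, Follows l a b → ∃ i, MoveDir p q i a b) : Φ.IsConnected := by
  obtain ⟨σ, hσ⟩ := hΦ
  refine ⟨⟨σ ⟨l[0], List.getElem_mem _⟩⟩, fun x y => ?_⟩
  obtain ⟨⟨a, ha⟩, rfl⟩ := σ.surjective x
  obtain ⟨⟨b, hb⟩, rfl⟩ := σ.surjective y
  apply LabeledDigraph.exists_hasDist_of_reflTransGen
  have h := reflTransGen_cycNext h2 ha hb
  induction h with
  | refl => exact .refl
  | tail _ hyz ih =>
    exact (ih hyz.mem_left).tail ((adj_iff_of_extraction hσ hm _ _).2 (.inl hyz))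

/-- A graph can be extracted from every cyclic sequence of squares. -/
theorem exists_isExtractedFrom (p q : ℤ) (l : List Square) :
    ∃ (V : Type u) (Φ : LabeledDigraph V), IsExtractedFrom Φ p q l :=
  ⟨ULift {a // a ∈ l}, ⟨fun x y i => (Follows l x.down.1 y.down.1 ∨ Follows l y.down.1 x.down.1) ∧
    MoveDir p q i x.down.1 y.down.1⟩, Equiv.ulift.symm, fun _ _ _ => Iff.rfl⟩

/-! ### The leaper graph on a frame -/

theorem two_mul_abs_lt {x y : ℤ} : 2 * |x| < y ↔ -y < 2 * x ∧ 2 * x < y := by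
  rw [show 2 * |x| = |2 * x| by rw [abs_mul]; rfl, abs_lt]

theorem inBand_zero {m n x : ℤ} : InBand m n 0 x ↔ -(n - m) < 2 * x ∧ 2 * x < n - m := by
  simp only [InBand, if_true, two_mul_abs_lt]

theorem inBand_one {m n x : ℤ} : InBand m n 1 x ↔ n - m < 2 * x ∧ 2 * x < m + n := by
  simp [InBand]

theorem inBand_neg_one {m n x : ℤ} :
    InBand m n (-1) x ↔ n - m < -(2 * x) ∧ -(2 * x) < m + n := by
  simp [InBand]

theorem octVec_one_one : ∀ i : Fin 8,
    ((octVec 1 1 i).1 = 0 ∨ (octVec 1 1 i).1 = 1 ∨ (octVec 1 1 i).1 = -1) ∧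
    ((octVec 1 1 i).2 = 0 ∨ (octVec 1 1 i).2 = 1 ∨ (octVec 1 1 i).2 = -1) := by decide

theorem octVec_one_one_injective : Function.Injective (octVec 1 1) := by
  unfold Function.Injective
  decide

theorem InBand.unique {m n s s' x : ℤ} (hs : s = 0 ∨ s = 1 ∨ s = -1)
    (hs' : s' = 0 ∨ s' = 1 ∨ s' = -1) (hmn : m < n) (h : InBand m n s x)
    (h' : InBand m n s' x) : s = s' := by
  rcases hs with rfl | rfl | rfl <;> rcases hs' with rfl | rfl | rfl <;>
    simp only [inBand_zero, inBand_one, inBand_neg_one] at h h' <;> omega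

/-- The sections of a frame are disjoint. -/
theorem frameSection_unique {m n : ℤ} (hmn : m < n) {a : Square} {i j : Fin 8}
    (hi : a ∈ frameSection m n i) (hj : a ∈ frameSection m n j) : i = j :=
  octVec_one_one_injective (Prod.ext
    (hi.1.unique (octVec_one_one i).1 (octVec_one_one j).1 hmn hj.1)
    (hi.2.unique (octVec_one_one i).2 (octVec_one_one j).2 hmn hj.2))

theorem frameSection_subset_board {m n : ℤ} (hm : 0 < m) (hmn : m < n) (i : Fin 8) :
    frameSection m n i ⊆ board m n := by
  have key : ∀ s x : ℤ, (s = 0 ∨ s = 1 ∨ s = -1) → InBand m n s x → 2 * |x| < m + n := by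
    rintro s x (rfl | rfl | rfl) h <;> rw [two_mul_abs_lt] <;>
      simp only [inBand_zero, inBand_one, inBand_neg_one] at h <;> omega
  exact fun a ha => ⟨key _ _ (octVec_one_one i).1 ha.1, key _ _ (octVec_one_one i).2 ha.2⟩

theorem dirMatrix_row : ∀ k r, (dirMatrix k r 0 = 0 ∧ (dirMatrix k r 1 = 1 ∨ dirMatrix k r 1 = -1)) ∨
    (dirMatrix k r 1 = 0 ∧ (dirMatrix k r 0 = 1 ∨ dirMatrix k r 0 = -1)) := by decide

/-- One coordinate of a move is ±m or ±n. A step ±n stays on the board only from the opposite outer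
band, and a step ±m leaves the board from the outer band on its own side. -/
theorem InBand.add_move {m n s x c d : ℤ} (hs : s = 0 ∨ s = 1 ∨ s = -1)
    (hcd : (c = 0 ∧ (d = 1 ∨ d = -1)) ∨ (d = 0 ∧ (c = 1 ∨ c = -1))) (hmn : m < n)
    (h : InBand m n s x) (h' : 2 * |x + (c * m + d * n)| < m + n) :
    (d = 0 ∨ s = -d) ∧ (c = 0 ∨ s ≠ c) := by
  rw [two_mul_abs_lt] at h'
  rcases hs with rfl | rfl | rfl <;>
    simp only [inBand_zero, inBand_one, inBand_neg_one] at h <;>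
    rcases hcd with ⟨rfl, rfl | rfl⟩ | ⟨rfl, rfl | rfl⟩ <;> omega

theorem eq_add_three_or_four : ∀ i k : Fin 8,
    (dirMatrix k 0 1 = 0 ∨ (octVec 1 1 i).1 = -dirMatrix k 0 1) ∧
      (dirMatrix k 0 0 = 0 ∨ (octVec 1 1 i).1 ≠ dirMatrix k 0 0) →
    (dirMatrix k 1 1 = 0 ∨ (octVec 1 1 i).2 = -dirMatrix k 1 1) ∧
      (dirMatrix k 1 0 = 0 ∨ (octVec 1 1 i).2 ≠ dirMatrix k 1 0) →
    k = i + 3 ∨ k = i + 4 := by decide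

/-- The moves of a leaper from a square of the frame which do not leave the board. -/
theorem moveDir_frameSection_board {m n : ℤ} (hmn : m < n) {a b : Square}
    {i k : Fin 8} (ha : a ∈ frameSection m n i) (hb : b ∈ board m n) (hab : MoveDir m n k a b) :
    k = i + 3 ∨ k = i + 4 := by
  rw [moveDir_iff] at hab
  obtain ⟨h1, h2⟩ := hab
  obtain ⟨h3, h4⟩ := hb
  rw [h1] at h3
  rw [h2] at h4
  exact eq_add_three_or_four i k
    (ha.1.add_move (octVec_one_one i).1 (dirMatrix_row k 0) hmn h3)
    (ha.2.add_move (octVec_one_one i).2 (dirMatrix_row k 1) hmn h4)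

/-- In a cycle of a leaper within the frame, the squares adjacent to `a` are all the squares of the
board to which the leaper can move from `a`. -/
theorem IsLeaperCycle.follows_of_moveDir {m n : ℤ} (hm : 0 < m) (hmn : m < n) {C : List Square}
    (hC : IsLeaperCycle m n C) (hF : ∀ a ∈ C, ∃ i, a ∈ frameSection m n i) {a b : Square}
    {k : Fin 8} (ha : a ∈ C) (hb : b ∈ board m n) (hab : MoveDir m n k a b) :
    Follows C a b ∨ Follows C b a := by
  obtain ⟨hnd, h3, hmove⟩ := hC
  obtain ⟨c, d, hc, hd, hcd⟩ := exists_cycPrev_cycNext hnd h3 ha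
  obtain ⟨i, hi⟩ := hF a ha
  have hboard : ∀ x ∈ C, x ∈ board m n := fun x hx =>
    let ⟨j, hj⟩ := hF x hx
    frameSection_subset_board hm hmn j hj
  obtain ⟨k₁, h₁⟩ := hmove c a hc
  obtain ⟨k₂, h₂⟩ := hmove a d hd
  replace h₁ := h₁.symm
  have e₀ := moveDir_frameSection_board hmn hi hb hab
  have e₁ := moveDir_frameSection_board hmn hi (hboard _ hc.mem_left) h₁
  have e₂ := moveDir_frameSection_board hmn hi (hboard _ hd.mem_right) h₂
  -- Predecessor and successor lie in distinct directions, both among the two that stay on the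
  -- board, so `k` must be one of them.
  have hne : k₁ + 4 ≠ k₂ := fun h => hcd (h₁.right_unique (h ▸ h₂))
  have : k = k₁ + 4 ∨ k = k₂ := by
    generalize k₁ + 4 = k₁ at *
    rcases e₀ with rfl | rfl <;> rcases e₁ with rfl | rfl <;> rcases e₂ with rfl | rfl <;> simp_all
  rcases this with rfl | rfl
  · right
    rw [hab.right_unique h₁]
    exact hc
  · left
    rw [hab.right_unique h₂]
    exact hd

/-! ### Shell cycles -/

/-- The two moves that may stay on the board lead from centre i to the centres i + 3 and i + 5 = i −
3. As 3 is coprime to 8, the eight centres form a single cycle. -/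
theorem octVec_add_move (m n : ℤ) : ∀ i : Fin 8,
    MoveDir m n (i + 3) (octVec (n - m) m i) (octVec (n - m) m (i + 3)) ∧
    MoveDir m n (i + 4) (octVec (n - m) m i) (octVec (n - m) m (i + 5)) := by
  intro i
  simp only [moveDir_iff]
  fin_cases i <;> simp [octVec, dirMatrix] <;> omega

theorem MoveDir.add_right {p q : ℤ} {k : Fin 8} {a b : Square} (h : MoveDir p q k a b)
    (t : Square) : MoveDir p q k (a + t) (b + t) := by
  rw [moveDir_iff] at *
  simp only [Prod.fst_add, Prod.snd_add]
  constructor <;> linarith [h.1, h.2]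

/-- The offset `t` is such that a shell of the frame contains the translates by `t` of the centres
of its eight subboards. -/
def IsShellOffset (m n : ℤ) (t : Square) : Prop :=
  (2 * |t.1| < n - m ∧ 2 * |t.1| < 3 * m - n) ∧ 2 * |t.2| < n - m ∧ 2 * |t.2| < 3 * m - n

/-- The inequality n ≤ 2m is equivalent to n − m ≤ 3m − n, so the side of a subboard is the smaller
of the two numbers and the case distinction disappears. -/
theorem mem_shell_iff {m n : ℤ} {a : Square} :
    a ∈ shell m n ↔ ∃ i, IsShellOffset m n (a - octVec (n - m) m i) := by
  refine exists_congr fun i => ?_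
  simp only [IsShellOffset, Prod.fst_sub, Prod.snd_sub]
  split_ifs <;> omega

theorem IsShellOffset.mem_frameSection {m n : ℤ} {t : Square} (ht : IsShellOffset m n t)
    (i : Fin 8) : octVec (n - m) m i + t ∈ frameSection m n i := by
  obtain ⟨⟨h1, h2⟩, h3, h4⟩ := ht
  rw [two_mul_abs_lt] at h1 h2 h3 h4
  fin_cases i <;>
    simp [frameSection, octVec, inBand_zero, inBand_one, inBand_neg_one] <;> omega

/-- The shell cycles are the cycles of the eight squares with the same offset. -/
theorem IsShellCycle.exists_offset {m n : ℤ} (hm : 0 < m) (hmn : m < n) {C : List Square}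
    (hC : IsShellCycle m n C) :
    ∃ t, IsShellOffset m n t ∧ vertexSet C = {a | ∃ i, a = octVec (n - m) m i + t} := by
  obtain ⟨hC, hshell⟩ := hC
  have hF : ∀ a ∈ C, ∃ i, a ∈ frameSection m n i := by
    intro a ha
    obtain ⟨i, hi⟩ := mem_shell_iff.1 (hshell ha)
    have := hi.mem_frameSection i
    rw [add_sub_cancel] at this
    exact ⟨i, this⟩
  have h3 := hC.2.1
  have h0 : C[0] ∈ C := List.getElem_mem _
  obtain ⟨i₀, hi₀⟩ := mem_shell_iff.1 (hshell h0)
  set t := C[0] - octVec (n - m) m i₀ with ht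
  have hb : ∀ i, octVec (n - m) m i + t ∈ board m n := fun i =>
    frameSection_subset_board hm hmn i (hi₀.mem_frameSection i)
  have hstep : ∀ i, octVec (n - m) m i + t ∈ C → octVec (n - m) m (i + 3) + t ∈ C := by
    intro i hi
    rcases hC.follows_of_moveDir hm hmn hF hi (hb (i + 3)) ((octVec_add_move m n i).1.add_right t)
      with h | h
    exacts [CycNext.mem_right h, CycNext.mem_left h]
  refine ⟨t, hi₀, Set.eq_of_subset_of_subset ?_ ?_⟩
  · intro a ha
    have h := reflTransGen_cycNext (by omega) h0 ha
    induction h with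
    | refl => exact ⟨i₀, by simp [ht]⟩
    | @tail b c _ hbc ih =>
      obtain ⟨i, rfl⟩ := ih hbc.mem_left
      obtain ⟨k, hk⟩ := hC.2.2 _ _ hbc
      obtain ⟨j, hj⟩ := hF _ hbc.mem_right
      rcases moveDir_frameSection_board hmn (hi₀.mem_frameSection i)
        (frameSection_subset_board hm hmn j hj) hk with rfl | rfl
      · exact ⟨_, hk.right_unique ((octVec_add_move m n i).1.add_right t)⟩
      · exact ⟨_, hk.right_unique ((octVec_add_move m n i).2.add_right t)⟩
  · rintro a ⟨i, rfl⟩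
    have hbase : octVec (n - m) m i₀ + t ∈ C := by simp [ht]
    have hall : ∀ k : Fin 8, octVec (n - m) m (i₀ + k * 3) + t ∈ C := by
      intro k
      induction k using Fin.induction with
      | zero => simpa using hbase
      | succ k ih =>
        have := hstep _ ih
        rwa [add_assoc, ← add_one_mul, Fin.coeSucc_eq_succ] at this
    -- Since 3 · 3 = 1 modulo 8, the number of steps of length 3 from i₀ to i is (i − i₀) · 3.
    have hi : ∀ i₀ i : Fin 8, i₀ + ((i - i₀) * 3) * 3 = i := by decide
    have := hall ((i - i₀) * 3)
    rwa [hi] at this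

/-! ### Formal squares -/

/-- The value of a formal square, a matrix acting on the pair `x`. -/
def act (M : Matrix (Fin 2) (Fin 2) ℤ) (x : ℤ × ℤ) : ℤ × ℤ :=
  (M 0 0 * x.1 + M 0 1 * x.2, M 1 0 * x.1 + M 1 1 * x.2)

theorem act_add (M N : Matrix (Fin 2) (Fin 2) ℤ) (x : ℤ × ℤ) :
    act (M + N) x = act M x + act N x := by
  ext <;> (simp [act]; ring)

theorem act_sub (M N : Matrix (Fin 2) (Fin 2) ℤ) (x : ℤ × ℤ) :
    act (M - N) x = act M x - act N x := by
  ext <;> (simp [act]; ring)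

theorem act_mul (M N : Matrix (Fin 2) (Fin 2) ℤ) (x : ℤ × ℤ) :
    act (M * N) x = act M (act N x) := by
  ext <;> (simp [act, Matrix.mul_apply, Fin.sum_univ_two]; ring)

theorem act_one (x : ℤ × ℤ) : act 1 x = x := by
  ext <;> simp [act]

theorem moveDir_iff_act {p q : ℤ} {k : Fin 8} {a b : Square} :
    MoveDir p q k a b ↔ b = a + act (dirMatrix k) (p, q) := by
  rw [moveDir_iff, Prod.ext_iff]
  rfl

/-! ### Liftings as matrices and as concatenations of source sections -/

namespace Lifting

theorem frame_eq_act (c : Lifting) (x : ℤ × ℤ) : c.frame x = act c.matrix x := by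
  cases c <;> ext <;> (simp [frame, act, matrix]; try ring)

theorem frame_pos (c : Lifting) {x : ℤ × ℤ} (h : 0 < x.1 ∧ x.1 < x.2) :
    0 < (c.frame x).1 ∧ (c.frame x).1 < (c.frame x).2 := by
  cases c <;> simp only [frame] <;> omega

/-- The sections of the old frame whose squares are lifted to the `i`-th section, in the order in
which the corresponding paths are concatenated. -/
def src : Lifting → Fin 8 → List (Fin 8)
  | f, i => if i.val % 2 = 0 then [i + 5, i + 4, i + 3] else [i]
  | g, i => if i.val % 2 = 0 then [i] else [i + 5, i + 4, i + 3]
  | h, i => if i.val % 2 = 0 then [i + 6, i + 5, i + 4, i + 3, i + 2] else [i - 1, i, i + 1]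

/-- The lifted path in the `i`-th section is a concatenation of reversed paths. -/
def reverses : Lifting → Fin 8 → Bool
  | f, i => i.val % 2 = 0
  | g, i => i.val % 2 = 1
  | h, i => i.val % 2 = 0

/-- The concatenation of old paths which is translated in a lifting. -/
def combine {α : Type*} (c : Lifting) (a : Fin 8 → List α) (i : Fin 8) : List α :=
  (c.src i).flatMap fun j => if c.reverses i then (a j).reverse else a j

theorem liftPaths_eq (c : Lifting) (F : ℤ × ℤ) (a : Fin 8 → List Square) (i : Fin 8) :
    c.liftPaths F a i = (c.combine a i).map (fun s => s + c.translation F i) := by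
  unfold liftPaths combine
  congr 1
  cases c <;> rcases Nat.mod_two_eq_zero_or_one i.val with h | h <;>
    simp [src, reverses, h, List.flatMap_cons]

theorem mem_combine {α : Type*} {c : Lifting} {a : Fin 8 → List α} {i : Fin 8} {x : α} :
    x ∈ c.combine a i ↔ ∃ j ∈ c.src i, x ∈ a j := by
  unfold combine
  rw [List.mem_flatMap]
  refine exists_congr fun j => and_congr_right fun _ => ?_
  split_ifs <;> simp

theorem map_combine {α β : Type*} (φ : α → β) (c : Lifting) (a : Fin 8 → List α) (i : Fin 8) :
    (c.combine a i).map φ = c.combine (fun j => (a j).map φ) i := by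
  unfold combine
  rw [List.map_flatMap]
  congr 1
  ext1 j
  split_ifs <;> simp

theorem nodup_src : ∀ (c : Lifting) (i : Fin 8), (c.src i).Nodup := by
  intro c
  cases c <;> decide

/-- The translations of the lifting, as formal vectors. -/
def transMat (c : Lifting) (i : Fin 8) : Matrix (Fin 2) (Fin 2) ℤ :=
  !![(c.translation (1, 0) i).1, (c.translation (0, 1) i).1;
    (c.translation (1, 0) i).2, (c.translation (0, 1) i).2]

theorem translation_eq_act (c : Lifting) (x : ℤ × ℤ) (i : Fin 8) :
    c.translation x i = act (c.transMat i) x := by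
  obtain ⟨m, n⟩ := x
  cases c <;> fin_cases i <;> ext <;> simp [translation, transMat, act, octVec] <;> ring

/-! ### The sections of a lifted frame -/

/-- The length of a coordinate of a translation. -/
def shift : Lifting → Fin 8 → ℤ × ℤ → ℤ
  | f, i, x => if i.val % 2 = 0 then x.1 + x.2 else x.1
  | g, i, x => if i.val % 2 = 0 then x.2 - x.1 else x.2
  | h, i, x => if i.val % 2 = 0 then x.1 + x.2 else x.2

theorem translation_eq_shift (c : Lifting) (x : ℤ × ℤ) (i : Fin 8) :
    c.translation x i =
      ((octVec 1 1 i).1 * c.shift i x, (octVec 1 1 i).2 * c.shift i x) := by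
  obtain ⟨m, n⟩ := x
  cases c <;> fin_cases i <;> simp [translation, shift, octVec]

/-- A band on the side `s` is lifted to the band on the side `s'` of the `i`-th section. -/
def liftsBand : Lifting → Fin 8 → ℤ → ℤ → Bool
  | f, i, s, s' => if i.val % 2 = 0 then s' = 0 ∨ s = -s' else s = s'
  | g, i, s, s' => if i.val % 2 = 0 then (s' = 0 ∧ s = 0) ∨ (s' ≠ 0 ∧ s ≠ -s') else s ≠ s'
  | h, i, s, s' => if i.val % 2 = 0 then s' = 0 ∨ s ≠ s' else s ≠ -s'

/-- A section is a product of two bands, so lifted sections can be recognised one coordinate at a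
time; `liftsBand` tabulates the outcome of the linear inequalities. In corner sections only the
outer bands occur. -/
theorem inBand_frame_iff (c : Lifting) (i : Fin 8) {m n s s' x : ℤ} (hm : 0 < m) (hmn : m < n)
    (hs : s = 0 ∨ s = 1 ∨ s = -1) (hs' : s' = 0 ∨ s' = 1 ∨ s' = -1)
    (hi : i.val % 2 = 1 → s' ≠ 0) (hx : InBand m n s x) :
    InBand (c.frame (m, n)).1 (c.frame (m, n)).2 s' (x + s' * c.shift i (m, n)) ↔
      c.liftsBand i s s' := by
  rcases Nat.mod_two_eq_zero_or_one i.val with h | h <;>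
    rcases hs' with rfl | rfl | rfl <;> rcases hs with rfl | rfl | rfl <;>
    simp [h] at hi <;> simp only [inBand_zero, inBand_one, inBand_neg_one] at hx <;>
    cases c <;> simp [h, liftsBand, shift, frame, inBand_zero, inBand_one, inBand_neg_one] <;>
    omega

/-- Reconciles the two notions of lifting: the sections that survive the intersection in `liftSet`
are those whose paths are concatenated in `liftPaths`. -/
theorem liftsBand_iff_mem_src : ∀ (c : Lifting) (i j : Fin 8),
    (c.liftsBand i (octVec 1 1 j).1 (octVec 1 1 i).1 ∧
      c.liftsBand i (octVec 1 1 j).2 (octVec 1 1 i).2) ↔ j ∈ c.src i := by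
  intro c
  cases c <;> decide

theorem octVec_ne_zero_of_odd : ∀ i : Fin 8, i.val % 2 = 1 →
    (octVec 1 1 i).1 ≠ 0 ∧ (octVec 1 1 i).2 ≠ 0 := by decide

/-- The squares of the `j`-th section are lifted to the `i`-th section if `j` is a source of
`i`. -/
theorem add_translation_mem_iff (c : Lifting) {x : ℤ × ℤ} (hx : 0 < x.1 ∧ x.1 < x.2) {a : Square}
    {i j : Fin 8} (ha : a ∈ frameSection x.1 x.2 j) :
    a + c.translation x i ∈ frameSection (c.frame x).1 (c.frame x).2 i ↔ j ∈ c.src i := by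
  rw [← liftsBand_iff_mem_src, translation_eq_shift]
  exact and_congr
    (c.inBand_frame_iff i hx.1 hx.2 (octVec_one_one j).1 (octVec_one_one i).1
      (fun h => (octVec_ne_zero_of_odd i h).1) ha.1)
    (c.inBand_frame_iff i hx.1 hx.2 (octVec_one_one j).2 (octVec_one_one i).2
      (fun h => (octVec_ne_zero_of_odd i h).2) ha.2)

end Lifting

theorem wordMatrix_cons (c : Lifting) (e : List Lifting) :
    wordMatrix (c :: e) = c.matrix * wordMatrix e := by
  simp [wordMatrix]

theorem proportions_append (e d : List Lifting) :
    proportions (e ++ d) = act (wordMatrix e) (proportions d) := by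
  induction e with
  | nil => simp [wordMatrix, act_one]
  | cons c e ih =>
    rw [wordMatrix_cons, act_mul, ← ih, ← c.frame_eq_act]
    rfl

theorem act_wordMatrix_pos (e : List Lifting) {x : ℤ × ℤ} (hx : 0 < x.1 ∧ x.1 < x.2) :
    0 < (act (wordMatrix e) x).1 ∧ (act (wordMatrix e) x).1 < (act (wordMatrix e) x).2 := by
  induction e with
  | nil => simpa [wordMatrix, act_one] using hx
  | cons c e ih =>
    rw [wordMatrix_cons, act_mul, ← c.frame_eq_act]
    exact c.frame_pos ih

theorem proportions_pos (e : List Lifting) :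
    0 < (proportions e).1 ∧ (proportions e).1 < (proportions e).2 := by
  have := act_wordMatrix_pos e (x := proportions []) (by simp [proportions])
  rwa [← proportions_append, List.append_nil] at this

/-! ### Lifted cycles of formal squares -/

/-- The centres of the subboards of a shell, as formal squares. -/
def baseMat (i : Fin 8) : Matrix (Fin 2) (Fin 2) ℤ :=
  !![(octVec (-1) 1 i).1, (octVec 1 0 i).1; (octVec (-1) 1 i).2, (octVec 1 0 i).2]

theorem octVec_eq_act (x : ℤ × ℤ) (i : Fin 8) :
    octVec (x.2 - x.1) x.1 i = act (baseMat i) x := by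
  fin_cases i <;> ext <;> simp [baseMat, act, octVec] <;> ring

/-- The partitioned cycle of descent `e`, as a cycle of formal squares. -/
def formalPaths : List Lifting → Fin 8 → List (Matrix (Fin 2) (Fin 2) ℤ)
  | [] => fun i => [baseMat i]
  | c :: e => fun i =>
      (c.combine (formalPaths e) i).map (fun P => P + c.transMat i * wordMatrix e)

theorem mem_formalPaths_cons {c : Lifting} {e : List Lifting} {i : Fin 8}
    {P : Matrix (Fin 2) (Fin 2) ℤ} : P ∈ formalPaths (c :: e) i ↔
      ∃ j ∈ c.src i, ∃ P₀ ∈ formalPaths e j, P₀ + c.transMat i * wordMatrix e = P := by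
  simp only [formalPaths, List.mem_map, Lifting.mem_combine]
  constructor
  · rintro ⟨P₀, ⟨j, hj, h⟩, rfl⟩
    exact ⟨j, hj, P₀, h, rfl⟩
  · rintro ⟨j, hj, P₀, h, rfl⟩
    exact ⟨P₀, ⟨j, hj, h⟩, rfl⟩

/-- The square with offset `t` given by a formal square. -/
def evalSq (x : ℤ × ℤ) (t : Square) (P : Matrix (Fin 2) (Fin 2) ℤ) : Square := act P x + t

theorem evalSq_add (x : ℤ × ℤ) (t : Square) (P Q : Matrix (Fin 2) (Fin 2) ℤ) :
    evalSq x t (P + Q) = evalSq x t P + act Q x := by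
  unfold evalSq
  rw [act_add]
  abel

/-- The pair `x` gives the proportions of a frame whose shell has the offset `t`. -/
def IsBase (x : ℤ × ℤ) (t : Square) : Prop := (0 < x.1 ∧ x.1 < x.2) ∧ IsShellOffset x.1 x.2 t

theorem isBase_one_two : IsBase (1, 2) 0 := by
  simp [IsBase, IsShellOffset]

variable {x : ℤ × ℤ} {t : Square}

/-- Uniform in the base: the section of a formal square depends only on `e`, never on `x` or `t`. -/
theorem evalSq_mem_frameSection (h : IsBase x t) {e : List Lifting} {i : Fin 8}
    {P : Matrix (Fin 2) (Fin 2) ℤ} (hP : P ∈ formalPaths e i) :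
    evalSq x t P ∈ frameSection (act (wordMatrix e) x).1 (act (wordMatrix e) x).2 i := by
  induction e generalizing i P with
  | nil =>
    obtain rfl : P = baseMat i := by simpa [formalPaths] using hP
    rw [evalSq, ← octVec_eq_act]
    simpa [wordMatrix, act_one] using h.2.mem_frameSection i
  | cons c e ih =>
    obtain ⟨j, hj, P₀, h₀, rfl⟩ := mem_formalPaths_cons.1 hP
    rw [evalSq_add, act_mul, ← c.translation_eq_act, wordMatrix_cons, act_mul, ← c.frame_eq_act]
    exact (c.add_translation_mem_iff (act_wordMatrix_pos e h.1) (ih h₀)).2 hj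

/-- Sections are disjoint, so equal values share a section and therefore underwent the same last
translation, which cancels. -/
theorem evalSq_inj (h : IsBase x t) {e : List Lifting} {i j : Fin 8}
    {P Q : Matrix (Fin 2) (Fin 2) ℤ} (hP : P ∈ formalPaths e i) (hQ : Q ∈ formalPaths e j)
    (hPQ : evalSq x t P = evalSq x t Q) : P = Q := by
  induction e generalizing i j P Q with
  | nil =>
    have hj := evalSq_mem_frameSection h hQ
    rw [← hPQ] at hj
    obtain rfl := frameSection_unique (act_wordMatrix_pos _ h.1).2
      (evalSq_mem_frameSection h hP) hj
    simp only [formalPaths, List.mem_singleton] at hP hQ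
    rw [hP, hQ]
  | cons c e ih =>
    have hj := evalSq_mem_frameSection h hQ
    rw [← hPQ] at hj
    obtain rfl := frameSection_unique (act_wordMatrix_pos _ h.1).2
      (evalSq_mem_frameSection h hP) hj
    obtain ⟨_, _, P₀, hP₀, rfl⟩ := mem_formalPaths_cons.1 hP
    obtain ⟨_, _, Q₀, hQ₀, rfl⟩ := mem_formalPaths_cons.1 hQ
    rw [evalSq_add, evalSq_add] at hPQ
    rw [ih hP₀ hQ₀ (add_right_cancel hPQ)]

/-- Separating formal sections takes only one base; (1, 2) with zero offset serves as the test base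
here and later. -/
theorem formalPaths_section_unique {e : List Lifting} {i j : Fin 8}
    {P : Matrix (Fin 2) (Fin 2) ℤ} (hP : P ∈ formalPaths e i) (hQ : P ∈ formalPaths e j) :
    i = j :=
  frameSection_unique (act_wordMatrix_pos e isBase_one_two.1).2
    (evalSq_mem_frameSection isBase_one_two hP) (evalSq_mem_frameSection isBase_one_two hQ)

theorem formalPaths_nodup (e : List Lifting) (i : Fin 8) : (formalPaths e i).Nodup := by
  induction e generalizing i with
  | nil => simp [formalPaths]
  | cons c e ih =>
    refine List.Nodup.map (add_left_injective _) ?_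
    unfold Lifting.combine
    rw [List.nodup_flatMap]
    refine ⟨fun j _ => by split_ifs <;> simp [ih], ?_⟩
    refine (c.nodup_src i).imp fun {j k} hjk => ?_
    intro P hj hk
    refine hjk (formalPaths_section_unique (P := P) (e := e) ?_ ?_)
    · revert hj; split_ifs <;> simp
    · revert hk; split_ifs <;> simp

/-- The cycle of formal squares of descent `e`. -/
def formalCycle (e : List Lifting) : List (Matrix (Fin 2) (Fin 2) ℤ) :=
  (List.ofFn (formalPaths e)).flatten

theorem mem_formalCycle {e : List Lifting} {P : Matrix (Fin 2) (Fin 2) ℤ} :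
    P ∈ formalCycle e ↔ ∃ i, P ∈ formalPaths e i := by
  unfold formalCycle
  rw [List.mem_flatten]
  exact ⟨fun ⟨l, hl, hP⟩ => let ⟨i, hi⟩ := List.mem_ofFn.1 hl; ⟨i, hi ▸ hP⟩,
    fun ⟨i, hi⟩ => ⟨_, List.mem_ofFn.2 ⟨i, rfl⟩, hi⟩⟩

theorem formalCycle_nodup (e : List Lifting) : (formalCycle e).Nodup := by
  unfold formalCycle
  rw [List.nodup_flatten]
  refine ⟨fun l hl => ?_, ?_⟩
  · obtain ⟨i, rfl⟩ := List.mem_ofFn.1 hl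
    exact formalPaths_nodup e i
  · rw [List.pairwise_ofFn]
    intro i j hij P hP hQ
    exact hij.ne (formalPaths_section_unique hP hQ)

theorem evalSq_injOn (h : IsBase x t) (e : List Lifting) {P Q : Matrix (Fin 2) (Fin 2) ℤ}
    (hP : P ∈ formalCycle e) (hQ : Q ∈ formalCycle e) (hPQ : evalSq x t P = evalSq x t Q) :
    P = Q :=
  let ⟨_, hi⟩ := mem_formalCycle.1 hP
  let ⟨_, hj⟩ := mem_formalCycle.1 hQ
  evalSq_inj h hi hj hPQ

/-- Here the arbitrary suffix `d` and the arbitrary shell cycle are absorbed into a base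
`(proportions d, t)`; the formal cycle depends on `e` alone. -/
theorem liftSets_eq (d e : List Lifting) (h : IsBase (proportions d) t) {S : Set Square}
    (hS : S = {a | ∃ i, a = octVec ((proportions d).2 - (proportions d).1) (proportions d).1 i + t}) :
    liftSets d e S = {a | ∃ P ∈ formalCycle e, evalSq (proportions d) t P = a} := by
  simp only [mem_formalCycle]
  induction e with
  | nil =>
    ext a
    simp [liftSets, hS, formalPaths, octVec_eq_act, evalSq, eq_comm]
  | cons c e ih =>
    ext b
    simp only [liftSets, ih, Lifting.liftSet, Set.mem_ofPred_eq, proportions_append]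
    constructor
    · rintro ⟨i, hb, P, ⟨j, hP⟩, hPb⟩
      have hb' : b = evalSq (proportions d) t P +
        c.translation (act (wordMatrix e) (proportions d)) i := by rw [hPb, sub_add_cancel]
      rw [hb', c.add_translation_mem_iff (act_wordMatrix_pos e h.1)
        (evalSq_mem_frameSection h hP)] at hb
      refine ⟨_, ⟨i, mem_formalPaths_cons.2 ⟨j, hb, P, hP, rfl⟩⟩, ?_⟩
      rw [evalSq_add, hb', act_mul, c.translation_eq_act]
    · rintro ⟨P, ⟨i, hP⟩, rfl⟩
      refine ⟨i, ?_, ?_⟩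
      · have := evalSq_mem_frameSection h hP
        rwa [wordMatrix_cons, act_mul, ← c.frame_eq_act] at this
      · obtain ⟨j, hj, P₀, hP₀, rfl⟩ := mem_formalPaths_cons.1 hP
        refine ⟨P₀, ⟨j, hP₀⟩, ?_⟩
        rw [evalSq_add, act_mul, c.translation_eq_act, add_sub_cancel_right]

theorem liftCycles_eq (d e : List Lifting) (t : Square) :
    liftCycles d e (fun i =>
      [octVec ((proportions d).2 - (proportions d).1) (proportions d).1 i + t]) =
    fun i => (formalPaths e i).map (evalSq (proportions d) t) := by
  induction e with
  | nil => simp [liftCycles, formalPaths, octVec_eq_act, evalSq]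
  | cons c e ih =>
    ext1 i
    rw [liftCycles, c.liftPaths_eq, ih, formalPaths, ← c.map_combine, List.map_map, List.map_map]
    congr 1
    ext1 P
    simp only [Function.comp_apply]
    rw [evalSq_add, act_mul, proportions_append, c.translation_eq_act]

/-! ### Moves of the leaper on a lifted set -/

namespace Lifting

-- A move of the new leaper from a copy of an old square leads either to another copy of that square
-- or to a copy of a square one old move away. Both sides are coefficients of the same `wordMatrix
-- e`, so finitely many cases settle every `e`.
set_option maxRecDepth 100000 in
set_option synthInstance.maxHeartbeats 200000 in
set_option synthInstance.maxSize 1000 in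
theorem exists_lifted_move : ∀ (c : Lifting) (i k j : Fin 8), (k = i + 3 ∨ k = i + 4) →
    j ∈ c.src i →
    (∃ i', (i' = k ∨ i' = k + 1) ∧ j ∈ c.src i' ∧
      c.transMat i + dirMatrix k * c.matrix = c.transMat i') ∨
    (∃ i', (i' = k ∨ i' = k + 1) ∧ ∃ k', (k' = j + 3 ∨ k' = j + 4) ∧
      (∀ j', j' = k' ∨ j' = k' + 1 → j' ∈ c.src i') ∧
      c.transMat i + dirMatrix k * c.matrix = dirMatrix k' + c.transMat i') := by
  intro c
  cases c <;> decide

/-- The copies of a square are connected by moves: from each copy, at most two moves lead to the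
copy in the section `hub`. -/
def hub : Lifting → Fin 8 → Fin 8
  | f, j => if j.val % 2 = 0 then j + 4 else j
  | g, j => if j.val % 2 = 0 then j else j + 4
  | h, j => if j.val % 2 = 0 then j + 4 else j

set_option maxRecDepth 100000 in
theorem exists_moves_to_hub : ∀ (c : Lifting) (i j : Fin 8), j ∈ c.src i →
    ∃ i', j ∈ c.src i' ∧
      (i' = i ∨ ∃ k, c.transMat i + dirMatrix k * c.matrix = c.transMat i') ∧
      (c.hub j = i' ∨ ∃ k, c.transMat i' + dirMatrix k * c.matrix = c.transMat (c.hub j)) := by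
  intro c
  cases c <;> decide

theorem mem_src_hub : ∀ (c : Lifting) (j : Fin 8), j ∈ c.src (c.hub j) := by
  intro c
  cases c <;> decide

-- Every old move is realised by a new move between suitable copies; with the connectedness of the
-- copies of one square, this carries connectedness of the old set to the lifted one.
set_option maxRecDepth 100000 in
theorem exists_copies_of_move : ∀ (c : Lifting) (j k j' : Fin 8), (k = j + 3 ∨ k = j + 4) →
    (j' = k ∨ j' = k + 1) → ∃ i, j ∈ c.src i ∧ ∃ i', j' ∈ c.src i' ∧
      ∃ k', c.transMat i + dirMatrix k' * c.matrix = dirMatrix k + c.transMat i' := by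
  intro c
  cases c <;> decide

end Lifting

set_option maxRecDepth 100000 in
theorem baseMat_add_dirMatrix : ∀ i k : Fin 8, (k = i + 3 ∨ k = i + 4) →
    ∃ j, (j = k ∨ j = k + 1) ∧ baseMat i + dirMatrix k = baseMat j := by decide

/-- The set of formal squares of descent `e` is closed under the moves of the leaper which do not
leave the board. -/
theorem add_move_mem_formalPaths {e : List Lifting} {i k : Fin 8}
    {P : Matrix (Fin 2) (Fin 2) ℤ} (hP : P ∈ formalPaths e i) (hk : k = i + 3 ∨ k = i + 4) :
    ∃ j, (j = k ∨ j = k + 1) ∧ P + dirMatrix k * wordMatrix e ∈ formalPaths e j := by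
  induction e generalizing i k P with
  | nil =>
    obtain rfl : P = baseMat i := by simpa [formalPaths] using hP
    obtain ⟨j, hj, h⟩ := baseMat_add_dirMatrix i k hk
    exact ⟨j, hj, by simp [wordMatrix, formalPaths, h]⟩
  | cons c e ih =>
    obtain ⟨j, hj, P₀, h₀, rfl⟩ := mem_formalPaths_cons.1 hP
    rw [wordMatrix_cons, ← Matrix.mul_assoc, add_assoc, ← Matrix.add_mul]
    rcases c.exists_lifted_move i k j hk hj with ⟨i', hi', hj', h⟩ | ⟨i', hi', k', hk', hj', h⟩
    · exact ⟨i', hi', mem_formalPaths_cons.2 ⟨j, hj', P₀, h₀, by rw [h]⟩⟩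
    · obtain ⟨j', hjk, hP'⟩ := ih h₀ hk'
      refine ⟨i', hi', mem_formalPaths_cons.2 ⟨j', hj' _ hjk, _, hP', ?_⟩⟩
      rw [h, Matrix.add_mul, add_assoc]

/-- Two formal squares of descent `e` joined by a move of the leaper. -/
def FormalMove (e : List Lifting) (P Q : Matrix (Fin 2) (Fin 2) ℤ) : Prop :=
  P ∈ formalCycle e ∧ Q ∈ formalCycle e ∧ ∃ k, P + dirMatrix k * wordMatrix e = Q

theorem FormalMove.symm {e : List Lifting} {P Q : Matrix (Fin 2) (Fin 2) ℤ}
    (h : FormalMove e P Q) : FormalMove e Q P := by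
  obtain ⟨hP, hQ, k, rfl⟩ := h
  refine ⟨hQ, hP, k + 4, ?_⟩
  rw [dirMatrix_add_four, Matrix.neg_mul, add_neg_cancel_right]

theorem reflTransGen_formalMove_symm {e : List Lifting} {P Q : Matrix (Fin 2) (Fin 2) ℤ}
    (h : Relation.ReflTransGen (FormalMove e) P Q) :
    Relation.ReflTransGen (FormalMove e) Q P := by
  induction h with
  | refl => exact .refl
  | tail _ h ih => exact ih.head h.symm

theorem mem_formalCycle_of_mem {e : List Lifting} {i : Fin 8} {P : Matrix (Fin 2) (Fin 2) ℤ}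
    (h : P ∈ formalPaths e i) : P ∈ formalCycle e := mem_formalCycle.2 ⟨i, h⟩

/-- Evaluation at (1, 2) places both ends on the board, which leaves only two candidates for the
direction. -/
theorem FormalMove.exists_dir {e : List Lifting} {P Q : Matrix (Fin 2) (Fin 2) ℤ}
    (h : FormalMove e P Q) : ∃ i j k, P ∈ formalPaths e i ∧ Q ∈ formalPaths e j ∧
      (k = i + 3 ∨ k = i + 4) ∧ (j = k ∨ j = k + 1) ∧ P + dirMatrix k * wordMatrix e = Q := by
  obtain ⟨hP, hQ, k, rfl⟩ := h
  obtain ⟨i, hi⟩ := mem_formalCycle.1 hP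
  obtain ⟨j, hj⟩ := mem_formalCycle.1 hQ
  have hpos := act_wordMatrix_pos e isBase_one_two.1
  have hk := moveDir_frameSection_board (k := k) hpos.2 (evalSq_mem_frameSection isBase_one_two hi)
    (frameSection_subset_board hpos.1 hpos.2 j (evalSq_mem_frameSection isBase_one_two hj))
    (by rw [moveDir_iff_act, evalSq_add, act_mul])
  obtain ⟨j', hj', h⟩ := add_move_mem_formalPaths hi hk
  obtain rfl := formalPaths_section_unique hj h
  exact ⟨i, j, k, hi, hj, hk, hj', rfl⟩

/-- The leaper can visit the whole lifted set. -/
theorem reflTransGen_formalMove (e : List Lifting) {P Q : Matrix (Fin 2) (Fin 2) ℤ}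
    (hP : P ∈ formalCycle e) (hQ : Q ∈ formalCycle e) :
    Relation.ReflTransGen (FormalMove e) P Q := by
  induction e generalizing P Q with
  | nil =>
    have step : ∀ i, FormalMove [] (baseMat i) (baseMat (i + 3)) := by
      intro i
      refine ⟨mem_formalCycle.2 ⟨i, by simp [formalPaths]⟩,
        mem_formalCycle.2 ⟨i + 3, by simp [formalPaths]⟩, i + 3, ?_⟩
      simp only [wordMatrix, List.map_nil, List.prod_nil, mul_one]
      revert i
      decide
    have hall : ∀ i k : Fin 8, Relation.ReflTransGen (FormalMove []) (baseMat i)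
        (baseMat (i + k * 3)) := by
      intro i k
      induction k using Fin.induction with
      | zero => simp [Relation.ReflTransGen.refl]
      | succ k ih =>
        have := ih.tail (step _)
        rwa [add_assoc, ← add_one_mul, Fin.coeSucc_eq_succ] at this
    obtain ⟨i, hi⟩ := mem_formalCycle.1 hP
    obtain ⟨j, hj⟩ := mem_formalCycle.1 hQ
    obtain rfl : P = baseMat i := by simpa [formalPaths] using hi
    obtain rfl : Q = baseMat j := by simpa [formalPaths] using hj
    have hij : ∀ i j : Fin 8, i + ((j - i) * 3) * 3 = j := by decide
    have := hall i ((j - i) * 3)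
    rwa [hij] at this
  | cons c e ih =>
    have copy : ∀ {i j : Fin 8} {P₀}, P₀ ∈ formalPaths e j → j ∈ c.src i →
        P₀ + c.transMat i * wordMatrix e ∈ formalCycle (c :: e) := fun h₀ hj =>
      mem_formalCycle_of_mem (mem_formalPaths_cons.2 ⟨_, hj, _, h₀, rfl⟩)
    have move : ∀ {i i' j j' k k' : Fin 8} {P₀}, P₀ ∈ formalPaths e j → j ∈ c.src i →
        P₀ + dirMatrix k * wordMatrix e ∈ formalPaths e j' → j' ∈ c.src i' →
        c.transMat i + dirMatrix k' * c.matrix = dirMatrix k + c.transMat i' →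
        FormalMove (c :: e) (P₀ + c.transMat i * wordMatrix e)
          (P₀ + dirMatrix k * wordMatrix e + c.transMat i' * wordMatrix e) := by
      intro i i' j j' k k' P₀ h₀ hj h₁ hj' h
      refine ⟨copy h₀ hj, copy h₁ hj', k', ?_⟩
      rw [wordMatrix_cons, ← Matrix.mul_assoc, add_assoc, ← Matrix.add_mul, h, Matrix.add_mul,
        add_assoc]
    have same : ∀ {i i' j k' : Fin 8} {P₀}, P₀ ∈ formalPaths e j → j ∈ c.src i →
        j ∈ c.src i' → c.transMat i + dirMatrix k' * c.matrix = c.transMat i' →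
        FormalMove (c :: e) (P₀ + c.transMat i * wordMatrix e)
          (P₀ + c.transMat i' * wordMatrix e) := by
      intro i i' j k' P₀ h₀ hj hj' h
      refine ⟨copy h₀ hj, copy h₀ hj', k', ?_⟩
      rw [wordMatrix_cons, ← Matrix.mul_assoc, add_assoc, ← Matrix.add_mul, h]
    have hub : ∀ {i j : Fin 8} {P₀}, P₀ ∈ formalPaths e j → j ∈ c.src i →
        Relation.ReflTransGen (FormalMove (c :: e)) (P₀ + c.transMat i * wordMatrix e)
          (P₀ + c.transMat (c.hub j) * wordMatrix e) := by
      intro i j P₀ h₀ hj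
      obtain ⟨i', hi', h1, h2⟩ := c.exists_moves_to_hub i j hj
      refine Relation.ReflTransGen.trans (b := P₀ + c.transMat i' * wordMatrix e) ?_ ?_
      · rcases h1 with rfl | ⟨k, h1⟩
        · exact .refl
        · exact .single (same h₀ hj hi' h1)
      · rcases h2 with h2 | ⟨k, h2⟩
        · rw [h2]
        · exact .single (same h₀ hi' (c.mem_src_hub j) h2)
    have copies : ∀ {i i' j : Fin 8} {P₀}, P₀ ∈ formalPaths e j → j ∈ c.src i → j ∈ c.src i' →
        Relation.ReflTransGen (FormalMove (c :: e)) (P₀ + c.transMat i * wordMatrix e)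
          (P₀ + c.transMat i' * wordMatrix e) := fun h₀ hj hj' =>
      (hub h₀ hj).trans (reflTransGen_formalMove_symm (hub h₀ hj'))
    obtain ⟨i, hi⟩ := mem_formalCycle.1 hP
    obtain ⟨j, hj, P₀, hP₀, rfl⟩ := mem_formalPaths_cons.1 hi
    obtain ⟨i', hi'⟩ := mem_formalCycle.1 hQ
    obtain ⟨j', hj', Q₀, hQ₀, rfl⟩ := mem_formalPaths_cons.1 hi'
    -- An old walk from `P₀` to `Q₀` is lifted step by step, with a change of copies wherever the
    -- next move starts from another copy.
    have h := ih (mem_formalCycle_of_mem hP₀) (mem_formalCycle_of_mem hQ₀)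
    clear hP hQ hi hi'
    induction h generalizing i' j' with
    | refl =>
      obtain rfl := formalPaths_section_unique hP₀ hQ₀
      exact copies hP₀ hj hj'
    | @tail R S _ hRS ih' =>
      obtain ⟨jR, jS, k, hR, hS, hk, hjk, hRS⟩ := hRS.exists_dir
      obtain rfl := formalPaths_section_unique hS hQ₀
      obtain ⟨a, ha, b, hb, k', hk'⟩ := c.exists_copies_of_move jR k jS hk hjk
      subst hRS
      exact ((ih' a jR ha hR).tail (move hR ha hS hb hk')).trans (copies hS hb hj')

/-! ### The ends of the paths of a lifted cycle -/

namespace Lifting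

theorem exists_src_eq_cons : ∀ (c : Lifting) (i : Fin 8),
    ∃ l, c.src i = (c.src i).headD 0 :: l := by
  intro c i
  cases c <;> rcases Nat.mod_two_eq_zero_or_one i.val with h | h <;> simp [src, h]

theorem exists_src_eq_append : ∀ (c : Lifting) (i : Fin 8),
    ∃ l, c.src i = l ++ [(c.src i).getLastD 0] := by
  intro c i
  have : c.src i ≠ [] := by
    obtain ⟨l, hl⟩ := c.exists_src_eq_cons i
    rw [hl]
    exact List.cons_ne_nil _ _
  refine ⟨(c.src i).dropLast, ?_⟩
  rw [List.getLastD_eq_getLast?, List.getLast?_eq_some_getLast this, Option.getD_some,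
    List.dropLast_append_getLast]

theorem head?_combine (c : Lifting) {α : Type*} {a : Fin 8 → List α} {hd lt : Fin 8 → α}
    (h : ∀ i, (a i).head? = some (hd i) ∧ (a i).getLast? = some (lt i)) (i : Fin 8) :
    (c.combine a i).head? =
      some (if c.reverses i then lt ((c.src i).headD 0) else hd ((c.src i).headD 0)) := by
  obtain ⟨l, hl⟩ := c.exists_src_eq_cons i
  unfold combine
  rw [hl, List.flatMap_cons, List.headD_cons]
  split_ifs <;> simp [h]

theorem getLast?_combine (c : Lifting) {α : Type*} {a : Fin 8 → List α} {hd lt : Fin 8 → α}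
    (h : ∀ i, (a i).head? = some (hd i) ∧ (a i).getLast? = some (lt i)) (i : Fin 8) :
    (c.combine a i).getLast? =
      some (if c.reverses i then hd ((c.src i).getLastD 0) else lt ((c.src i).getLastD 0)) := by
  obtain ⟨l, hl⟩ := c.exists_src_eq_append i
  unfold combine
  generalize (c.src i).getLastD 0 = j at *
  rw [hl, List.flatMap_append, List.flatMap_singleton]
  split_ifs <;> simp [h]

/-- The formal square `X` at the start of the northeast path is lifted to
`c.cornerCoeff * X + c.cornerShift * N`, where `N` are the proportions of the frame. -/
def cornerCoeff : Lifting → Matrix (Fin 2) (Fin 2) ℤ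
  | f => 1
  | g => 1
  | h => dirMatrix 4

/-- The coefficient at the proportions of the frame in the lift of the start of the northeast path;
see `Lifting.cornerCoeff`. -/
def cornerShift : Lifting → Matrix (Fin 2) (Fin 2) ℤ
  | f => !![1, 0; 1, 0]
  | g => !![-1, 1; 0, 0]
  | h => !![0, 2; 1, 1]

end Lifting

/-- The start of the northeast path of the cycle of formal squares of descent `e`. -/
def cornerMat : List Lifting → Matrix (Fin 2) (Fin 2) ℤ
  | [] => baseMat 1
  | c :: e => c.cornerCoeff * cornerMat e + c.cornerShift * wordMatrix e

/-- The coefficients at `cornerMat e` and at `wordMatrix e` of the start of the `i`-th path. -/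
def headCoeff (i : Fin 8) : Matrix (Fin 2) (Fin 2) ℤ × Matrix (Fin 2) (Fin 2) ℤ :=
  if i.val % 2 = 0 then (dirMatrix (i + 4), -dirMatrix (i + 4)) else (dirMatrix i, 0)

/-- The coefficients at `cornerMat e` and at `wordMatrix e` of the end of the `i`-th path. -/
def lastCoeff (i : Fin 8) : Matrix (Fin 2) (Fin 2) ℤ × Matrix (Fin 2) (Fin 2) ℤ :=
  if i.val % 2 = 0 then (dirMatrix (i + 3), -dirMatrix (i + 3)) else (dirMatrix (i + 7), 0)

/-- The start of the `i`-th path of the cycle of formal squares of descent `e`. -/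
def pathHead (e : List Lifting) (i : Fin 8) : Matrix (Fin 2) (Fin 2) ℤ :=
  (headCoeff i).1 * cornerMat e + (headCoeff i).2 * wordMatrix e

/-- The end of the `i`-th path of the cycle of formal squares of descent `e`. -/
def pathLast (e : List Lifting) (i : Fin 8) : Matrix (Fin 2) (Fin 2) ℤ :=
  (lastCoeff i).1 * cornerMat e + (lastCoeff i).2 * wordMatrix e

theorem pathHead_nil : ∀ i, pathHead [] i = baseMat i := by decide

theorem pathLast_nil : ∀ i, pathLast [] i = baseMat i := by decide

/-- By symmetry one matrix, `cornerMat e`, determines all sixteen ends of paths: the ends of corner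
paths are its images, and the start of side path i is one move of the first leaper away from the end
of corner path i + 5. Comparing the coefficients of `cornerMat e` and `wordMatrix e` makes the
induction step a finite check. -/
theorem headCoeff_lift : ∀ (c : Lifting) (i : Fin 8),
    let j := (c.src i).headD 0
    let p := if c.reverses i then lastCoeff j else headCoeff j
    (headCoeff i).1 * c.cornerCoeff = p.1 ∧
      (headCoeff i).1 * c.cornerShift + (headCoeff i).2 * c.matrix = p.2 + c.transMat i := by
  intro c
  cases c <;> decide

theorem lastCoeff_lift : ∀ (c : Lifting) (i : Fin 8),
    let j := (c.src i).getLastD 0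
    let p := if c.reverses i then headCoeff j else lastCoeff j
    (lastCoeff i).1 * c.cornerCoeff = p.1 ∧
      (lastCoeff i).1 * c.cornerShift + (lastCoeff i).2 * c.matrix = p.2 + c.transMat i := by
  intro c
  cases c <;> decide

theorem lift_coeff {c : Lifting} {i : Fin 8}
    {p q : Matrix (Fin 2) (Fin 2) ℤ × Matrix (Fin 2) (Fin 2) ℤ} (h₁ : p.1 * c.cornerCoeff = q.1)
    (h₂ : p.1 * c.cornerShift + p.2 * c.matrix = q.2 + c.transMat i) (e : List Lifting) :
    p.1 * cornerMat (c :: e) + p.2 * wordMatrix (c :: e) =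
      q.1 * cornerMat e + q.2 * wordMatrix e + c.transMat i * wordMatrix e := by
  rw [add_assoc, ← Matrix.add_mul, ← h₁, ← h₂, cornerMat, wordMatrix_cons]
  simp only [Matrix.mul_add, Matrix.add_mul, Matrix.mul_assoc]
  abel

theorem pathHead_cons (c : Lifting) (e : List Lifting) (i : Fin 8) :
    pathHead (c :: e) i = (if c.reverses i then pathLast e ((c.src i).headD 0)
      else pathHead e ((c.src i).headD 0)) + c.transMat i * wordMatrix e := by
  have h := headCoeff_lift c i
  dsimp only at h
  rw [pathHead, lift_coeff h.1 h.2]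
  split_ifs <;> rfl

theorem pathLast_cons (c : Lifting) (e : List Lifting) (i : Fin 8) :
    pathLast (c :: e) i = (if c.reverses i then pathHead e ((c.src i).getLastD 0)
      else pathLast e ((c.src i).getLastD 0)) + c.transMat i * wordMatrix e := by
  have h := lastCoeff_lift c i
  dsimp only at h
  rw [pathLast, lift_coeff h.1 h.2]
  split_ifs <;> rfl

theorem formalPaths_ends (e : List Lifting) (i : Fin 8) :
    (formalPaths e i).head? = some (pathHead e i) ∧
      (formalPaths e i).getLast? = some (pathLast e i) := by
  induction e generalizing i with
  | nil => simp [formalPaths, pathHead_nil, pathLast_nil]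
  | cons c e ih =>
    rw [formalPaths, List.head?_map, List.getLast?_map, c.head?_combine ih, c.getLast?_combine ih,
      pathHead_cons, pathLast_cons]
    exact ⟨rfl, rfl⟩

theorem pathHead_mem (e : List Lifting) (i : Fin 8) : pathHead e i ∈ formalPaths e i :=
  List.mem_of_head? (formalPaths_ends e i).1

theorem pathLast_mem (e : List Lifting) (i : Fin 8) : pathLast e i ∈ formalPaths e i :=
  List.mem_of_getLast? (formalPaths_ends e i).2

theorem formalPaths_ne_nil (e : List Lifting) (i : Fin 8) : formalPaths e i ≠ [] :=
  List.ne_nil_of_mem (pathHead_mem e i)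

/-! ### The moves of the second leaper -/

/-- The moves of the second leaper are `dirMatrix k * secondMat`. -/
def secondMat : Matrix (Fin 2) (Fin 2) ℤ := !![2, -1; 1, 0]

/-- Two formal squares joined by a move of the second leaper. -/
def SecondMove (P Q : Matrix (Fin 2) (Fin 2) ℤ) : Prop := ∃ k, Q - P = dirMatrix k * secondMat

theorem SecondMove.symm {P Q : Matrix (Fin 2) (Fin 2) ℤ} (h : SecondMove P Q) :
    SecondMove Q P := by
  obtain ⟨k, hk⟩ := h
  exact ⟨k + 4, by rw [dirMatrix_add_four, Matrix.neg_mul, ← hk, neg_sub]⟩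

theorem SecondMove.add_right {P Q : Matrix (Fin 2) (Fin 2) ℤ} (h : SecondMove P Q)
    (R : Matrix (Fin 2) (Fin 2) ℤ) : SecondMove (P + R) (Q + R) := by
  obtain ⟨k, hk⟩ := h
  exact ⟨k, by rw [← hk]; abel⟩

/-- The matrix (1 − A₄) · `cornerMat e` + A₄ · `wordMatrix e` is, up to a symmetry, the step from
the end of one path to the start of the next. A lifting only multiplies it on the left by a
direction matrix, so it never leaves the class of `secondMat`, its value for empty `e`. -/
theorem corner_lift : ∀ c : Lifting, ∃ k,
    (1 - dirMatrix 3) * c.cornerCoeff = dirMatrix k * (1 - dirMatrix 3) ∧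
    (1 - dirMatrix 3) * c.cornerShift + dirMatrix 3 * c.matrix = dirMatrix k * dirMatrix 3 := by
  intro c
  cases c <;> decide

theorem corner_secondMat (e : List Lifting) : ∃ k,
    (1 - dirMatrix 3) * cornerMat e + dirMatrix 3 * wordMatrix e = dirMatrix k * secondMat := by
  induction e with
  | nil => decide
  | cons c e ih =>
    obtain ⟨k, hk⟩ := ih
    obtain ⟨k', h₁, h₂⟩ := corner_lift c
    obtain ⟨k'', h⟩ := exists_dirMatrix_mul k' k
    refine ⟨k'', ?_⟩
    rw [← h, Matrix.mul_assoc, ← hk, Matrix.mul_add, ← Matrix.mul_assoc, ← Matrix.mul_assoc, ← h₁,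
      ← h₂, cornerMat, wordMatrix_cons]
    simp only [Matrix.mul_add, Matrix.add_mul, Matrix.mul_assoc]
    abel

theorem junction_coeff : ∀ i : Fin 8, ∃ k,
    (headCoeff (i + 1)).1 - (lastCoeff i).1 = dirMatrix k * (1 - dirMatrix 3) ∧
    (headCoeff (i + 1)).2 - (lastCoeff i).2 = dirMatrix k * dirMatrix 3 := by decide

theorem secondMove_junction (e : List Lifting) (i : Fin 8) :
    SecondMove (pathLast e i) (pathHead e (i + 1)) := by
  obtain ⟨k, h₁, h₂⟩ := junction_coeff i
  obtain ⟨k', hk'⟩ := corner_secondMat e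
  obtain ⟨k'', h⟩ := exists_dirMatrix_mul k k'
  refine ⟨k'', ?_⟩
  rw [← h, Matrix.mul_assoc, ← hk', Matrix.mul_add, ← Matrix.mul_assoc, ← Matrix.mul_assoc, ← h₁,
    ← h₂, pathHead, pathLast, Matrix.sub_mul, Matrix.sub_mul]
  abel

/-- The sections joined in a new path are cyclically consecutive, in descending order when the paths
are reversed. So every junction inside a new path is an old junction between sections. -/
theorem Lifting.isChain_src : ∀ (c : Lifting) (i : Fin 8),
    (c.src i).IsChain fun j j' => if c.reverses i then j = j' + 1 else j' = j + 1 := by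
  intro c
  cases c <;> decide

theorem isChain_formalPaths (e : List Lifting) (i : Fin 8) :
    (formalPaths e i).IsChain SecondMove := by
  induction e generalizing i with
  | nil => simp [formalPaths]
  | cons c e ih =>
    rw [formalPaths, List.isChain_map]
    refine List.IsChain.imp (R := SecondMove) (fun P Q h => h.add_right _) ?_
    unfold Lifting.combine
    rw [List.flatMap_def, List.isChain_flatten]
    · refine ⟨?_, ?_⟩
      · intro l hl
        obtain ⟨j, -, rfl⟩ := List.mem_map.1 hl
        split_ifs
        · rw [List.isChain_reverse]
          exact (ih j).imp fun _ _ h => h.symm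
        · exact ih j
      · rw [List.isChain_map]
        refine (c.isChain_src i).imp fun j j' h P hP Q hQ => ?_
        split_ifs at h hP hQ with hr
        · rw [List.getLast?_reverse, (formalPaths_ends e j).1] at hP
          rw [List.head?_reverse, (formalPaths_ends e j').2] at hQ
          obtain rfl := Option.mem_some.1 hP
          obtain rfl := Option.mem_some.1 hQ
          rw [h]
          exact (secondMove_junction e j').symm
        · rw [(formalPaths_ends e j).2] at hP
          rw [(formalPaths_ends e j').1] at hQ
          obtain rfl := Option.mem_some.1 hP
          obtain rfl := Option.mem_some.1 hQ
          rw [h]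
          exact secondMove_junction e j
    · intro h
      obtain ⟨j, -, hj⟩ := List.mem_map.1 h
      split_ifs at hj <;> simp [formalPaths_ne_nil] at hj

theorem CycNext.secondMove {e : List Lifting} {P Q : Matrix (Fin 2) (Fin 2) ℤ}
    (h : CycNext (formalCycle e) P Q) : SecondMove P Q := by
  rcases h.flatten_cases (formalPaths_ne_nil e) (formalCycle_nodup e) with ⟨i, hi⟩ | ⟨i, hP, hQ⟩
  · have := (isChain_formalPaths e i).infix hi
    simpa using this
  · rw [(formalPaths_ends e _).2] at hP
    rw [(formalPaths_ends e _).1] at hQ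
    obtain rfl := Option.mem_some.1 hP
    obtain rfl := Option.mem_some.1 hQ
    exact secondMove_junction e i

/-! ### Adjacent squares of a lifted set -/

/-- Two squares with a common side. -/
def IsNear (a b : Square) : Prop := ∃ k, MoveDir 0 1 k a b

theorem IsNear.symm {a b : Square} (h : IsNear a b) : IsNear b a :=
  let ⟨k, hk⟩ := h
  ⟨k + 4, hk.symm⟩

theorem IsNear.cases {a b : Square} (h : IsNear a b) :
    (b.1 = a.1 ∧ (b.2 = a.2 + 1 ∨ b.2 = a.2 - 1)) ∨
    (b.2 = a.2 ∧ (b.1 = a.1 + 1 ∨ b.1 = a.1 - 1)) := by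
  obtain ⟨k, hk⟩ := h
  rw [moveDir_iff] at hk
  fin_cases k <;> simp [dirMatrix] at hk <;> omega

theorem IsNear.of_sub_eq {a b a' b' : Square} (h : IsNear a b) (h' : b' - a' = b - a) :
    IsNear a' b' := by
  obtain ⟨k, hk⟩ := h
  refine ⟨k, ?_⟩
  rw [moveDir_iff_act] at *
  rw [← sub_eq_iff_eq_add'] at *
  rw [h', hk]

theorem InBand.eq_or_eq_add {m n s s' x x' δ : ℤ} (hs : s = 0 ∨ s = 1 ∨ s = -1)
    (hs' : s' = 0 ∨ s' = 1 ∨ s' = -1) (hmn : m < n) (h : InBand m n s x)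
    (h' : InBand m n s' x') (hδ : δ = 1 ∨ δ = -1) (hx : x' = x + δ) : s' = s ∨ s' = s + δ := by
  rcases hs with rfl | rfl | rfl <;> rcases hs' with rfl | rfl | rfl <;>
    simp only [inBand_zero, inBand_one, inBand_neg_one] at h h' <;> omega

/-- The parameter in `Fin 2` encodes the sign 2δ − 1 = ±1, which keeps the statement decidable. -/
theorem octVec_step : ∀ i j : Fin 8, ∀ δ : Fin 2,
    ((octVec 1 1 j).1 = (octVec 1 1 i).1 →
      ((octVec 1 1 j).2 = (octVec 1 1 i).2 ∨ (octVec 1 1 j).2 = (octVec 1 1 i).2 + (2 * (δ.val : ℤ) - 1)) →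
      i = j ∨ ((j = i + 1 ∨ i = j + 1) ∧
        octVec 1 1 j - octVec 1 1 i = (0, 2 * (δ.val : ℤ) - 1))) ∧
    ((octVec 1 1 j).2 = (octVec 1 1 i).2 →
      ((octVec 1 1 j).1 = (octVec 1 1 i).1 ∨ (octVec 1 1 j).1 = (octVec 1 1 i).1 + (2 * (δ.val : ℤ) - 1)) →
      i = j ∨ ((j = i + 1 ∨ i = j + 1) ∧
        octVec 1 1 j - octVec 1 1 i = (2 * (δ.val : ℤ) - 1, 0))) := by decide

/-- Squares with a common side lie in the same section or in adjacent sections. -/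
theorem IsNear.section_cases {m n : ℤ} (hmn : m < n) {a b : Square} {i j : Fin 8}
    (ha : a ∈ frameSection m n i) (hb : b ∈ frameSection m n j) (h : IsNear a b) :
    i = j ∨ ((j = i + 1 ∨ i = j + 1) ∧ b - a = octVec 1 1 j - octVec 1 1 i) := by
  have hδ : ∀ δ : ℤ, (δ = 1 ∨ δ = -1) → ∃ δ' : Fin 2, δ = 2 * δ'.val - 1 := by
    rintro δ (rfl | rfl)
    exacts [⟨1, by norm_num⟩, ⟨0, by norm_num⟩]
  have key : ∀ δ : ℤ, (δ = 1 ∨ δ = -1) →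
      (b.1 = a.1 → b.2 = a.2 + δ → i = j ∨ ((j = i + 1 ∨ i = j + 1) ∧
        b - a = octVec 1 1 j - octVec 1 1 i)) ∧
      (b.2 = a.2 → b.1 = a.1 + δ → i = j ∨ ((j = i + 1 ∨ i = j + 1) ∧
        b - a = octVec 1 1 j - octVec 1 1 i)) := by
    intro δ h1
    obtain ⟨δ', rfl⟩ := hδ δ h1
    constructor <;> intro e₁ e₂
    · have e := (ha.1.unique (octVec_one_one i).1 (octVec_one_one j).1 hmn (e₁ ▸ hb.1)).symm
      refine ((octVec_step i j δ').1 e (ha.2.eq_or_eq_add (octVec_one_one i).2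
        (octVec_one_one j).2 hmn hb.2 h1 e₂)).imp_right (And.imp_right fun h => ?_)
      rw [h]
      ext <;> simp [e₁, e₂]
    · have e := (ha.2.unique (octVec_one_one i).2 (octVec_one_one j).2 hmn (e₁ ▸ hb.2)).symm
      refine ((octVec_step i j δ').2 e (ha.1.eq_or_eq_add (octVec_one_one i).1
        (octVec_one_one j).1 hmn hb.1 h1 e₂)).imp_right (And.imp_right fun h => ?_)
      rw [h]
      ext <;> simp [e₁, e₂]
  rcases h.cases with ⟨h1, h2 | h2⟩ | ⟨h1, h2 | h2⟩
  exacts [(key 1 (.inl rfl)).1 h1 h2, (key (-1) (.inr rfl)).1 h1 h2,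
    (key 1 (.inl rfl)).2 h1 h2, (key (-1) (.inr rfl)).2 h1 h2]

namespace Lifting

/-- The direction of a move of the leaper from the source of a square of the `i`-th section, if the
paths are reversed in this section, which leads to a square near to the source of an adjacent
square of the `j`-th section. -/
def crossing : Lifting → Fin 8 → Fin 8 → Fin 8
  | h, i, j => if j = i + 1 then i + 6 else i + 1
  | _, i, j => if j = i + 1 then i + 7 else i

/-- Translations of adjacent sections differ by a move of the old leaper. One such move at the
source therefore undoes the effect of the border between the sections. -/
theorem dirMatrix_crossing : ∀ (c : Lifting) (i j : Fin 8), c.reverses i → (j = i + 1 ∨ i = j + 1) →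
    dirMatrix (c.crossing i j) = c.transMat i - c.transMat j := by
  intro c
  cases c <;> decide

/-- A coordinate that changes its band at the border is extreme in its section, and this pins down
the band of its source. -/
theorem inBand_crossing (c : Lifting) (i : Fin 8) {m n s s' s'' x : ℤ} (hm : 0 < m) (hmn : m < n)
    (hs : s = 0 ∨ s = 1 ∨ s = -1) (hs' : s' = 0 ∨ s' = 1 ∨ s' = -1)
    (hs'' : s'' = 0 ∨ s'' = 1 ∨ s'' = -1) (hi : c.reverses i) (hne : s'' ≠ s')
    (heven : i.val % 2 = 0 → s' = 0) (hodd : i.val % 2 = 1 → s'' = 0) (hx : InBand m n s x)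
    (h : InBand (c.frame (m, n)).1 (c.frame (m, n)).2 s''
      (x + s' * c.shift i (m, n) + (s'' - s'))) :
    s = if i.val % 2 = 0 then s'' else -s' := by
  rcases Nat.mod_two_eq_zero_or_one i.val with h2 | h2 <;> simp only [h2] at heven hodd ⊢
  · obtain rfl := heven trivial
    rcases hs'' with rfl | rfl | rfl <;> rcases hs with rfl | rfl | rfl <;>
      simp only [inBand_zero, inBand_one, inBand_neg_one] at hx <;>
      cases c <;> simp [h2, reverses, shift, frame, inBand_one, inBand_neg_one] at * <;>
      omega
  · obtain rfl := hodd trivial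
    rcases hs' with rfl | rfl | rfl <;> rcases hs with rfl | rfl | rfl <;>
      simp only [inBand_zero, inBand_one, inBand_neg_one] at hx <;>
      cases c <;> simp [h2, reverses, shift, frame, inBand_zero] at * <;>
      omega

theorem crossing_source : ∀ (c : Lifting) (i j j₀ : Fin 8), c.reverses i →
    (j = i + 1 ∨ i = j + 1) → j₀ ∈ c.src i →
    ((octVec 1 1 j).1 ≠ (octVec 1 1 i).1 → (octVec 1 1 j₀).1 =
      if i.val % 2 = 0 then (octVec 1 1 j).1 else -(octVec 1 1 i).1) →
    ((octVec 1 1 j).2 ≠ (octVec 1 1 i).2 → (octVec 1 1 j₀).2 =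
      if i.val % 2 = 0 then (octVec 1 1 j).2 else -(octVec 1 1 i).2) →
    c.crossing i j = j₀ + 3 ∨ c.crossing i j = j₀ + 4 := by
  intro c
  cases c <;> decide

theorem octVec_parity : ∀ i j : Fin 8, (j = i + 1 ∨ i = j + 1) →
    ((octVec 1 1 j).1 ≠ (octVec 1 1 i).1 →
      (i.val % 2 = 0 → (octVec 1 1 i).1 = 0) ∧ (i.val % 2 = 1 → (octVec 1 1 j).1 = 0)) ∧
    ((octVec 1 1 j).2 ≠ (octVec 1 1 i).2 →
      (i.val % 2 = 0 → (octVec 1 1 i).2 = 0) ∧ (i.val % 2 = 1 → (octVec 1 1 j).2 = 0)) := by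
  decide

/-- The bands forced at the border make the crossing one of the two directions under which the old
formal set is closed. -/
theorem crossing_mem (c : Lifting) {x : ℤ × ℤ} (hx : 0 < x.1 ∧ x.1 < x.2) {a : Square}
    {i j j₀ : Fin 8} (hi : c.reverses i) (hij : j = i + 1 ∨ i = j + 1) (hj₀ : j₀ ∈ c.src i)
    (ha : a ∈ frameSection x.1 x.2 j₀)
    (hb : a + c.translation x i + (octVec 1 1 j - octVec 1 1 i) ∈
      frameSection (c.frame x).1 (c.frame x).2 j) :
    c.crossing i j = j₀ + 3 ∨ c.crossing i j = j₀ + 4 := by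
  rw [translation_eq_shift] at hb
  obtain ⟨p₁, p₂⟩ := octVec_parity i j hij
  exact crossing_source c i j j₀ hi hij hj₀
    (fun h => c.inBand_crossing i hx.1 hx.2 (octVec_one_one j₀).1 (octVec_one_one i).1
      (octVec_one_one j).1 hi h (p₁ h).1 (p₁ h).2 ha.1 hb.1)
    (fun h => c.inBand_crossing i hx.1 hx.2 (octVec_one_one j₀).2 (octVec_one_one i).2
      (octVec_one_one j).2 hi h (p₂ h).1 (p₂ h).2 ha.2 hb.2)

theorem reverses_of_adjacent : ∀ (c : Lifting) (i j : Fin 8), (j = i + 1 ∨ i = j + 1) →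
    (c.reverses i ∧ c.reverses j = false) ∨ (c.reverses j ∧ c.reverses i = false) := by
  intro c
  cases c <;> decide

/-- After the crossing the two old squares lie in different sections. If these are adjacent, the
source `j₀` is the first or last section of path j, on the side of the border to section i. -/
theorem crossing_target : ∀ (c : Lifting) (i j j₀ j₁ : Fin 8), c.reverses i →
    (j = i + 1 ∨ i = j + 1) → j₀ ∈ c.src j →
    (j₁ = c.crossing i j ∨ j₁ = c.crossing i j + 1) → j₁ ≠ j₀ ∧
      (j₀ = j₁ + 1 → j = i + 1 ∧ j₀ = (c.src j).headD 0) ∧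
      (j₁ = j₀ + 1 → i = j + 1 ∧ j₀ = (c.src j).getLastD 0) := by
  intro c
  cases c <;> decide

theorem add_one_infix_src : ∀ (c : Lifting) (i j : Fin 8), j ∈ c.src i → j + 1 ∈ c.src i →
    if c.reverses i then [j + 1, j] <:+: c.src i else [j, j + 1] <:+: c.src i := by
  intro c
  cases c <;> decide

end Lifting

/-! ### Neighbours in concatenated and reversed paths -/

/-- Two elements of the list `l` are neighbours. -/
def AreNeighbours {α : Type*} (l : List α) (x y : α) : Prop := [x, y] <:+: l ∨ [y, x] <:+: l

theorem AreNeighbours.symm {α : Type*} {l : List α} {x y : α} (h : AreNeighbours l x y) :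
    AreNeighbours l y x := Or.symm h

theorem AreNeighbours.reverse {α : Type*} {l : List α} {x y : α} (h : AreNeighbours l x y) :
    AreNeighbours l.reverse x y := by
  unfold AreNeighbours at *
  rcases h with h | h
  · exact .inr (by simpa using List.reverse_infix.2 h)
  · exact .inl (by simpa using List.reverse_infix.2 h)

theorem AreNeighbours.infix {α : Type*} {l l' : List α} {x y : α} (h : AreNeighbours l x y)
    (hl : l <:+: l') : AreNeighbours l' x y :=
  h.imp (·.trans hl) (·.trans hl)

theorem AreNeighbours.map {α β : Type*} {l : List α} {x y : α} (h : AreNeighbours l x y)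
    (φ : α → β) : AreNeighbours (l.map φ) (φ x) (φ y) :=
  h.imp (fun h => by simpa using h.map φ) (fun h => by simpa using h.map φ)

theorem areNeighbours_append {α : Type*} {l l' : List α} {x y : α} (hx : x ∈ l.getLast?)
    (hy : y ∈ l'.head?) : AreNeighbours (l ++ l') x y := by
  rw [← List.dropLast_append_getLast? x hx, ← List.cons_head?_tail hy]
  exact .inl ⟨l.dropLast, l'.tail, by simp⟩

theorem flatMap_infix {α β : Type*} {l l' : List α} (φ : α → List β) (h : l <:+: l') :
    l.flatMap φ <:+: l'.flatMap φ := by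
  obtain ⟨s, t, rfl⟩ := h
  exact ⟨s.flatMap φ, t.flatMap φ, by simp⟩

namespace Lifting

theorem areNeighbours_combine (c : Lifting) {α : Type*} {a : Fin 8 → List α} {i j : Fin 8}
    {x y : α} (hj : j ∈ c.src i) (h : AreNeighbours (a j) x y) :
    AreNeighbours (c.combine a i) x y := by
  obtain ⟨s, t, hst⟩ := List.append_of_mem hj
  have h1 : [j] <:+: c.src i := ⟨s, t, by simp [hst]⟩
  refine AreNeighbours.infix ?_ (flatMap_infix _ h1)
  rw [List.flatMap_singleton]
  split_ifs
  exacts [h.reverse, h]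

theorem areNeighbours_combine_junction (c : Lifting) {α : Type*} {a : Fin 8 → List α}
    {i j : Fin 8} {x y : α} (hj : j ∈ c.src i) (hj' : j + 1 ∈ c.src i) (hx : x ∈ (a j).getLast?)
    (hy : y ∈ (a (j + 1)).head?) : AreNeighbours (c.combine a i) x y := by
  have h := c.add_one_infix_src i j hj hj'
  unfold combine
  split_ifs at h with hr
  · refine AreNeighbours.infix (AreNeighbours.symm ?_) (flatMap_infix _ h)
    simp only [hr, if_true, List.flatMap_cons, List.flatMap_nil, List.append_nil]
    exact areNeighbours_append (by rwa [List.getLast?_reverse]) (by rwa [List.head?_reverse])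
  · refine AreNeighbours.infix ?_ (flatMap_infix _ h)
    simp only [hr, List.flatMap_cons, List.flatMap_nil, List.append_nil]
    exact areNeighbours_append hx hy

end Lifting

/-- The formal squares `P` and `Q` of the `i`-th and the `j`-th path are adjacent in the cycle of
formal squares. -/
def AreAdjacent (e : List Lifting) (i j : Fin 8) (P Q : Matrix (Fin 2) (Fin 2) ℤ) : Prop :=
  (i = j ∧ AreNeighbours (formalPaths e i) P Q) ∨
  (j = i + 1 ∧ P = pathLast e i ∧ Q = pathHead e j) ∨
  (i = j + 1 ∧ Q = pathLast e j ∧ P = pathHead e i)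

theorem AreAdjacent.symm {e : List Lifting} {i j : Fin 8} {P Q : Matrix (Fin 2) (Fin 2) ℤ}
    (h : AreAdjacent e i j P Q) : AreAdjacent e j i Q P := by
  rcases h with ⟨rfl, h⟩ | h | h
  exacts [.inl ⟨rfl, h.symm⟩, .inr (.inr h), .inr (.inl h)]

theorem AreAdjacent.cycNext {e : List Lifting} {i j : Fin 8} {P Q : Matrix (Fin 2) (Fin 2) ℤ}
    (h : AreAdjacent e i j P Q) : CycNext (formalCycle e) P Q ∨ CycNext (formalCycle e) Q P := by
  rcases h with ⟨rfl, h | h⟩ | ⟨rfl, rfl, rfl⟩ | ⟨rfl, rfl, rfl⟩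
  · exact .inl (CycNext.flatten_of_infix _ i h)
  · exact .inr (CycNext.flatten_of_infix _ i h)
  · exact .inl (CycNext.flatten_of_junction _ i (formalPaths_ends e i).2
      (formalPaths_ends e _).1)
  · exact .inr (CycNext.flatten_of_junction _ j (formalPaths_ends e j).2
      (formalPaths_ends e _).1)

/-- At (1, 2) the second leaper degenerates to a (0, 1)-leaper, so its moves become steps between
squares with a common side. -/
theorem act_secondMat : act secondMat (1, 2) = (0, 1) := by decide

theorem SecondMove.isNear {P Q : Matrix (Fin 2) (Fin 2) ℤ} (h : SecondMove P Q) :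
    IsNear (evalSq (1, 2) 0 P) (evalSq (1, 2) 0 Q) := by
  obtain ⟨k, hk⟩ := h
  refine ⟨k, ?_⟩
  rw [moveDir_iff_act, ← act_secondMat, ← act_mul, ← hk, ← evalSq_add, add_sub_cancel]

theorem evalSq_sub (x : ℤ × ℤ) (t : Square) (P Q : Matrix (Fin 2) (Fin 2) ℤ) :
    evalSq x t P - evalSq x t Q = act (P - Q) x := by
  unfold evalSq
  rw [act_sub]
  abel

theorem not_isNear_self (a : Square) : ¬ IsNear a a := by
  intro h
  have := h.cases
  omega

/-- Crossing moves the source of `P` to a square with the same difference to the source of `Q` as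
`P` has to `Q`. By induction these old squares are adjacent, and since their sections differ they
meet at a junction. So `Q` is an end of its path, and `P` has to be the facing end of the other. -/
theorem areAdjacent_of_reverses {c : Lifting} {e : List Lifting}
    (ih : ∀ {i j : Fin 8} {P Q : Matrix (Fin 2) (Fin 2) ℤ}, P ∈ formalPaths e i →
      Q ∈ formalPaths e j → IsNear (evalSq (1, 2) 0 P) (evalSq (1, 2) 0 Q) → AreAdjacent e i j P Q)
    {i j : Fin 8} {P Q : Matrix (Fin 2) (Fin 2) ℤ} (hi : c.reverses i)
    (hj : c.reverses j = false) (hij : j = i + 1 ∨ i = j + 1) (hP : P ∈ formalPaths (c :: e) i)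
    (hQ : Q ∈ formalPaths (c :: e) j)
    (hPQ : IsNear (evalSq (1, 2) 0 P) (evalSq (1, 2) 0 Q)) : AreAdjacent (c :: e) i j P Q := by
  have hpos := act_wordMatrix_pos (c :: e) isBase_one_two.1
  have hsec : ∀ {i P}, P ∈ formalPaths (c :: e) i → evalSq (1, 2) 0 P ∈ frameSection _ _ i :=
    fun h => evalSq_mem_frameSection isBase_one_two h
  have hne : i ≠ j := by
    rintro rfl
    simp [hi] at hj
  have hdiff : ∀ {P'}, P' ∈ formalPaths (c :: e) i →
      IsNear (evalSq (1, 2) 0 P') (evalSq (1, 2) 0 Q) →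
      evalSq (1, 2) 0 Q - evalSq (1, 2) 0 P' = octVec 1 1 j - octVec 1 1 i := fun h h' =>
    ((h'.section_cases hpos.2 (hsec h) (hsec hQ)).resolve_left hne).2
  -- Across the border the difference of two near squares is fixed by the sections, so `Q` has at
  -- most one near square in section i.
  have huniq : ∀ {P'}, P' ∈ formalPaths (c :: e) i →
      IsNear (evalSq (1, 2) 0 P') (evalSq (1, 2) 0 Q) → P = P' := fun h h' =>
    evalSq_inj isBase_one_two hP h (sub_right_injective ((hdiff hP hPQ).trans (hdiff h h').symm))
  obtain ⟨i₀, hi₀, P₀, hP₀, hPP₀⟩ := mem_formalPaths_cons.1 hP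
  obtain ⟨j₀, hj₀, Q₀, hQ₀, hQQ₀⟩ := mem_formalPaths_cons.1 hQ
  have hk : c.crossing i j = i₀ + 3 ∨ c.crossing i j = i₀ + 4 := by
    refine c.crossing_mem (act_wordMatrix_pos e isBase_one_two.1) hi hij hi₀
      (evalSq_mem_frameSection isBase_one_two hP₀) ?_
    rw [c.translation_eq_act, ← act_mul, ← evalSq_add, hPP₀, ← hdiff hP hPQ, add_sub_cancel,
      c.frame_eq_act, ← act_mul, ← wordMatrix_cons]
    exact hsec hQ
  obtain ⟨j₁, hj₁, hP₁⟩ := add_move_mem_formalPaths hP₀ hk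
  have hadj := ih hP₁ hQ₀ (hPQ.of_sub_eq (by
    rw [evalSq_sub, evalSq_sub, ← hPP₀, ← hQQ₀, c.dirMatrix_crossing i j hi hij, Matrix.sub_mul]
    congr 1
    abel))
  obtain ⟨h₁, h₂, h₃⟩ := c.crossing_target i j j₀ j₁ hi hij hj₀ hj₁
  rcases hadj with ⟨h, -⟩ | ⟨h, -, hQ₀'⟩ | ⟨h, hQ₀', -⟩
  · exact absurd h h₁
  · obtain ⟨rfl, rfl⟩ := h₂ h
    have hQ' : Q = pathHead (c :: e) (i + 1) := by
      rw [pathHead_cons, hj, ← hQQ₀, hQ₀']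
      simp
    refine .inr (.inl ⟨rfl, huniq (pathLast_mem _ _) ?_, hQ'⟩)
    rw [hQ']
    exact (secondMove_junction _ _).isNear
  · obtain ⟨rfl, rfl⟩ := h₃ h
    have hQ' : Q = pathLast (c :: e) j := by
      rw [pathLast_cons, hj, ← hQQ₀, hQ₀']
      simp
    refine .inr (.inr ⟨rfl, hQ', huniq (pathHead_mem _ _) ?_⟩)
    rw [hQ']
    exact (secondMove_junction _ _).symm.isNear

/-- Squares with a common side in the lifted set of the `(1, 2)`-frame are adjacent in the cycle of
the second leaper. -/
theorem areAdjacent_of_isNear {e : List Lifting} {i j : Fin 8} {P Q : Matrix (Fin 2) (Fin 2) ℤ}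
    (hP : P ∈ formalPaths e i) (hQ : Q ∈ formalPaths e j)
    (hPQ : IsNear (evalSq (1, 2) 0 P) (evalSq (1, 2) 0 Q)) : AreAdjacent e i j P Q := by
  have hpos := act_wordMatrix_pos e isBase_one_two.1
  have hcases := hPQ.section_cases hpos.2 (evalSq_mem_frameSection isBase_one_two hP)
    (evalSq_mem_frameSection isBase_one_two hQ)
  induction e generalizing i j P Q with
  | nil =>
    obtain rfl : P = baseMat i := by simpa [formalPaths] using hP
    obtain rfl : Q = baseMat j := by simpa [formalPaths] using hQ
    rcases hcases with rfl | ⟨h | h, -⟩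
    · exact absurd hPQ (not_isNear_self _)
    · exact .inr (.inl ⟨h, (pathLast_nil i).symm, (pathHead_nil j).symm⟩)
    · exact .inr (.inr ⟨h, (pathLast_nil j).symm, (pathHead_nil i).symm⟩)
  | cons c e ih =>
    have ih' : ∀ {i j : Fin 8} {P Q : Matrix (Fin 2) (Fin 2) ℤ}, P ∈ formalPaths e i →
        Q ∈ formalPaths e j → IsNear (evalSq (1, 2) 0 P) (evalSq (1, 2) 0 Q) →
        AreAdjacent e i j P Q := fun hP hQ h =>
      have hpos := act_wordMatrix_pos e isBase_one_two.1
      ih hP hQ h hpos (h.section_cases hpos.2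
        (evalSq_mem_frameSection isBase_one_two hP) (evalSq_mem_frameSection isBase_one_two hQ))
    rcases hcases with rfl | ⟨hij, -⟩
    · obtain ⟨i₀, hi₀, P₀, hP₀, rfl⟩ := mem_formalPaths_cons.1 hP
      obtain ⟨j₀, hj₀, Q₀, hQ₀, rfl⟩ := mem_formalPaths_cons.1 hQ
      refine .inl ⟨rfl, AreNeighbours.map ?_ fun P => P + c.transMat i * wordMatrix e⟩
      rcases ih' hP₀ hQ₀ (hPQ.of_sub_eq (by
        rw [evalSq_sub, evalSq_sub, add_sub_add_right_eq_sub])) with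
        ⟨rfl, h⟩ | ⟨rfl, rfl, rfl⟩ | ⟨rfl, rfl, rfl⟩
      · exact c.areNeighbours_combine hi₀ h
      · exact c.areNeighbours_combine_junction hi₀ hj₀ (formalPaths_ends e _).2
          (formalPaths_ends e _).1
      · exact (c.areNeighbours_combine_junction hj₀ hi₀ (formalPaths_ends e _).2
          (formalPaths_ends e _).1).symm
    · rcases c.reverses_of_adjacent i j hij with ⟨h, h'⟩ | ⟨h, h'⟩
      · exact areAdjacent_of_reverses ih' h h' hij hP hQ hPQ
      · exact (areAdjacent_of_reverses ih' h h' hij.symm hQ hP hPQ.symm).symm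

/-! ### Existence of the leaper cycles -/

theorem CycNext.of_map {α β : Type*} {l : List α} {φ : α → β} {a b : β}
    (h : CycNext (l.map φ) a b) : ∃ a' b', φ a' = a ∧ φ b' = b ∧ CycNext l a' b' := by
  obtain ⟨i, hi, h2, rfl, rfl⟩ := cycNext_iff.1 h
  simp only [List.length_map] at hi h2
  refine ⟨l[i], l[(i + 1) % l.length]'(Nat.mod_lt _ (by omega)), by simp, by simp,
    cycNext_iff.2 ⟨i, hi, h2, rfl, rfl⟩⟩

/-- In a finite connected graph all of whose vertices have exactly two neighbours, a cycle visits
all the vertices. -/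
theorem exists_hamiltonian_cycle {V : Type*} [Finite V] [Nonempty V] {G : SimpleGraph V}
    (h2 : ∀ v, (G.neighborSet v).ncard = 2) (hG : ∀ v w, G.Reachable v w) :
    ∃ l : List V, l.Nodup ∧ 3 ≤ l.length ∧ (∀ v, v ∈ l) ∧ ∀ v w, CycNext l v w → G.Adj v w := by
  classical
  obtain ⟨v⟩ := ‹Nonempty V›
  have hn : (G.neighborSet v).Nonempty :=
    Set.nonempty_of_ncard_ne_zero (by rw [h2]; exact two_ne_zero)
  have hcyc : G.IsCycles := fun v _ => h2 v
  obtain ⟨p, hp, hverts⟩ := hcyc.exists_cycle_toSubgraph_verts_eq_connectedComponentSupp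
    (c := G.connectedComponentMk v) (v := v) rfl hn
  have h3 := hp.three_le_length
  -- The support of a closed walk contains its base vertex at both ends; the tail of the support
  -- lists each vertex of the cycle once.
  have hlen : p.support.tail.length = p.length := by simp
  have hget : ∀ (i : ℕ) (hi : i < p.support.tail.length),
      p.support.tail[i] = p.getVert (i + 1) := by
    intro i hi
    rw [List.getElem_tail, SimpleGraph.Walk.support_getElem_eq_getVert]
  refine ⟨p.support.tail, hp.support_nodup, by omega, fun w => ?_, fun a b hab => ?_⟩
  · have hw : w ∈ p.support := by
      rw [← SimpleGraph.Walk.mem_verts_toSubgraph, hverts]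
      exact SimpleGraph.ConnectedComponent.sound (hG w v)
    rw [← SimpleGraph.Walk.cons_tail_support] at hw
    rcases List.mem_cons.1 hw with rfl | hw
    · exact SimpleGraph.Walk.end_mem_tail_support 
        (fun h => by have := SimpleGraph.Walk.length_eq_zero_iff.2 h; omega)
    · exact hw
  · obtain ⟨i, hi, -, rfl, rfl⟩ := cycNext_iff.1 hab
    rw [hget, hget]
    rcases Nat.lt_or_ge (i + 1) p.support.tail.length with h | h
    · rw [Nat.mod_eq_of_lt h]
      exact p.adj_getVert_succ (by omega)
    · have e : i + 1 = p.length := by omega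
      rw [hlen, e, Nat.mod_self, p.getVert_length]
      have := p.adj_getVert_succ (i := 0) (by omega)
      rwa [p.getVert_zero] at this

/-- The graph of the moves of the leaper on the set of formal squares of descent `e`. -/
def moveGraph (e : List Lifting) : SimpleGraph {P // P ∈ formalCycle e} where
  Adj P Q := FormalMove e P.1 Q.1
  symm := ⟨fun _ _ h => h.symm⟩
  loopless := ⟨fun P h => by
    obtain ⟨i, j, k, hi, hj, hk, hjk, -⟩ := h.exists_dir
    obtain rfl := formalPaths_section_unique hi hj
    revert hk hjk
    generalize P.1 = P at *
    clear hi hj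
    revert i k
    decide⟩

theorem exists_wordMatrix_inverse (e : List Lifting) :
    ∃ U, wordMatrix e * U = 1 ∧ U * wordMatrix e = 1 := by
  induction e with
  | nil => exact ⟨1, by simp [wordMatrix]⟩
  | cons c e ih =>
    obtain ⟨U, h₁, h₂⟩ := ih
    obtain ⟨V, h₃, h₄⟩ : ∃ V, c.matrix * V = 1 ∧ V * c.matrix = 1 := by
      cases c
      exacts [⟨!![1, 0; -2, 1], by decide⟩, ⟨!![2, -1; 1, 0], by decide⟩,
        ⟨!![-2, 1; 1, 0], by decide⟩]
    refine ⟨U * V, ?_, ?_⟩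
    · rw [wordMatrix_cons, Matrix.mul_assoc, ← Matrix.mul_assoc (wordMatrix e), h₁, Matrix.one_mul,
        h₃]
    · rw [wordMatrix_cons, Matrix.mul_assoc, ← Matrix.mul_assoc V, h₄, Matrix.one_mul, h₂]

theorem dirMatrix_injective : Function.Injective dirMatrix := by
  unfold Function.Injective
  decide

/-- Both admissible moves stay in the formal set and no other move does; they have different targets
because `wordMatrix e` is invertible. -/
theorem moveGraph_neighborSet_ncard (e : List Lifting) (P : {P // P ∈ formalCycle e}) :
    ((moveGraph e).neighborSet P).ncard = 2 := by
  obtain ⟨i, hi⟩ := mem_formalCycle.1 P.2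
  obtain ⟨j, -, hj⟩ := add_move_mem_formalPaths hi (.inl rfl)
  obtain ⟨j', -, hj'⟩ := add_move_mem_formalPaths hi (.inr rfl)
  rw [Set.ncard_eq_two]
  refine ⟨⟨_, mem_formalCycle_of_mem hj⟩, ⟨_, mem_formalCycle_of_mem hj'⟩, ?_, ?_⟩
  · intro h
    obtain ⟨U, hU, -⟩ := exists_wordMatrix_inverse e
    have h := congrArg (· * U) (add_left_cancel (Subtype.mk.inj h))
    simp only [Matrix.mul_assoc, hU, Matrix.mul_one] at h
    have := dirMatrix_injective h
    revert this
    clear * -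
    revert i
    decide
  · ext Q
    simp only [SimpleGraph.mem_neighborSet, moveGraph, Set.mem_insert_iff, Set.mem_singleton_iff,
      Subtype.ext_iff]
    constructor
    · intro h
      obtain ⟨i', _, k, hi', -, hk, -, hQ⟩ := h.exists_dir
      obtain rfl := formalPaths_section_unique hi hi'
      rw [← hQ]
      rcases hk with rfl | rfl
      exacts [.inl rfl, .inr rfl]
    · rintro (h | h) <;> exact ⟨P.2, Q.2, _, h.symm⟩

theorem moveGraph_reachable (e : List Lifting) (P Q : {P // P ∈ formalCycle e}) :
    (moveGraph e).Reachable P Q := by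
  obtain ⟨P, hP⟩ := P
  obtain ⟨Q, hQ⟩ := Q
  have h := reflTransGen_formalMove e hP hQ
  induction h with
  | refl => rfl
  | tail _ h ih => exact (ih h.1).trans (SimpleGraph.Adj.reachable h)

theorem vertexSet_map_evalSq (x : ℤ × ℤ) (t : Square) (e : List Lifting) :
    vertexSet ((formalCycle e).map (evalSq x t)) =
      {a | ∃ P ∈ formalCycle e, evalSq x t P = a} := by
  ext a
  simp [vertexSet]

theorem nodup_map_evalSq (h : IsBase x t) (e : List Lifting) :
    ((formalCycle e).map (evalSq x t)).Nodup :=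
  (formalCycle_nodup e).map_on fun _ hP _ hQ => evalSq_injOn h e hP hQ

/-- The leaper cycle over the set of squares of descent `e`. -/
theorem exists_leaperCycle (h : IsBase x t) (e : List Lifting) :
    ∃ C, IsLeaperCycle (act (wordMatrix e) x).1 (act (wordMatrix e) x).2 C ∧
      vertexSet C = {a | ∃ P ∈ formalCycle e, evalSq x t P = a} := by
  have : Nonempty {P // P ∈ formalCycle e} := ⟨⟨_, mem_formalCycle_of_mem (pathHead_mem e 0)⟩⟩
  obtain ⟨l, hnd, h3, hall, hadj⟩ := exists_hamiltonian_cycle (moveGraph_neighborSet_ncard e)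
    (moveGraph_reachable e)
  refine ⟨l.map fun P => evalSq x t P.1, ⟨?_, by simpa using h3, ?_⟩, ?_⟩
  · exact hnd.map fun P Q hPQ => Subtype.ext (evalSq_injOn h e P.2 Q.2 hPQ)
  · intro a b hab
    obtain ⟨P, Q, rfl, rfl, hPQ⟩ := CycNext.of_map hab
    obtain ⟨-, -, k, hk⟩ := hadj _ _ hPQ
    refine ⟨k, ?_⟩
    rw [moveDir_iff_act, ← hk, evalSq_add, act_mul]
  · ext a
    simp [vertexSet, hall]

theorem vertexSet_length_eq {l l' : List Square} (hl : l.Nodup) (hl' : l'.Nodup)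
    (h : vertexSet l = vertexSet l') : l.length = l'.length :=
  ((List.perm_ext_iff_of_nodup hl hl').2 fun a => Set.ext_iff.1 h a).length_eq

theorem three_le_length_formalCycle (e : List Lifting) : 3 ≤ (formalCycle e).length := by
  obtain ⟨C, hC, hv⟩ := exists_leaperCycle isBase_one_two e
  have := vertexSet_length_eq hC.1 (nodup_map_evalSq isBase_one_two e)
    (hv.trans (vertexSet_map_evalSq _ _ _).symm)
  rw [List.length_map] at this
  exact this ▸ hC.2.1

theorem exists_shellCycle (h : IsBase x t) : ∃ C, IsShellCycle x.1 x.2 C ∧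
    vertexSet C = {a | ∃ i, a = octVec (x.2 - x.1) x.1 i + t} := by
  obtain ⟨C, hC, hv⟩ := exists_leaperCycle h []
  have hv' : vertexSet C = {a | ∃ i, a = octVec (x.2 - x.1) x.1 i + t} := by
    rw [hv]
    ext a
    simp only [mem_formalCycle, formalPaths, List.mem_singleton, Set.mem_ofPred_eq, octVec_eq_act]
    exact ⟨fun ⟨_, ⟨i, hi⟩, ha⟩ => ⟨i, by rw [← ha, hi]; rfl⟩,
      fun ⟨i, ha⟩ => ⟨_, ⟨i, rfl⟩, ha.symm⟩⟩
  simp only [wordMatrix, List.map_nil, List.prod_nil, act_one] at hC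
  refine ⟨C, ⟨hC, ?_⟩, hv'⟩
  rw [hv']
  rintro a ⟨i, rfl⟩
  exact mem_shell_iff.2 ⟨i, by rw [add_sub_cancel_left]; exact h.2⟩

theorem evalSq_mem_board (h : IsBase x t) {e : List Lifting} {P : Matrix (Fin 2) (Fin 2) ℤ}
    (hP : P ∈ formalCycle e) :
    evalSq x t P ∈ board (act (wordMatrix e) x).1 (act (wordMatrix e) x).2 := by
  obtain ⟨i, hi⟩ := mem_formalCycle.1 hP
  have hpos := act_wordMatrix_pos e h.1
  exact frameSection_subset_board hpos.1 hpos.2 i (evalSq_mem_frameSection h hi)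

theorem isSkewBasic_proportions (e : List Lifting) :
    IsSkewBasic (proportions e).1 (proportions e).2 := by
  obtain ⟨h₁, h₂⟩ := proportions_pos e
  refine ⟨h₁, h₂, ?_⟩
  clear h₁ h₂
  induction e with
  | nil => exact ⟨⟨1, by norm_num [proportions]⟩, 1, 0, by norm_num [proportions]⟩
  | cons c e ih =>
    obtain ⟨⟨k, hk⟩, a, b, hab⟩ := ih
    rw [proportions]
    generalize proportions e = y at *
    obtain ⟨m, n⟩ := y
    -- The new Bézout coefficients are the row (a, b) times the inverse of `c.matrix`.
    cases c
    · exact ⟨⟨k + m, by simp only [Lifting.frame] at *; linarith⟩, a - 2 * b, b, by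
        simp only [Lifting.frame] at *; linear_combination hab⟩
    · exact ⟨⟨n + (n - 1 - k) , by simp only [Lifting.frame] at *; linarith⟩, b + 2 * a, -a, by
        simp only [Lifting.frame] at *; linear_combination hab⟩
    · exact ⟨⟨k + n, by simp only [Lifting.frame] at *; linarith⟩, b - 2 * a, a, by
        simp only [Lifting.frame] at *; linear_combination hab⟩

/-! ### Existence of both fundamental direction cycles -/

theorem flatten_liftCycles (d e : List Lifting) (t : Square) :
    (List.ofFn (liftCycles d e (fun i =>
      [octVec ((proportions d).2 - (proportions d).1) (proportions d).1 i + t]))).flatten =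
    (formalCycle e).map (evalSq (proportions d) t) := by
  rw [liftCycles_eq, formalCycle, List.map_flatten, List.map_ofFn]
  rfl

theorem exists_isFundamentalCycle (e : List Lifting) :
    ∃ (V : Type u) (Φ : LabeledDigraph V), IsFundamentalCycle e Φ := by
  obtain ⟨C, hC, hv⟩ := exists_leaperCycle isBase_one_two e
  obtain ⟨C₀, hC₀, hv₀⟩ := exists_shellCycle isBase_one_two
  have hp : proportions e = act (wordMatrix e) (1, 2) := by
    rw [← List.append_nil e, proportions_append, List.append_nil]
    rfl
  rw [← hp] at hC
  obtain ⟨V, Φ, hΦ⟩ := exists_isExtractedFrom (proportions e).1 (proportions e).2 C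
  refine ⟨V, Φ, _, _, C, isSkewBasic_proportions e, ⟨hC, ?_⟩,
    ⟨[], by rw [List.append_nil], C₀, hC₀, ?_⟩, hΦ⟩
  · rw [hv, hp]
    rintro a ⟨P, hP, rfl⟩
    exact evalSq_mem_board isBase_one_two hP
  · rw [hv, liftSets_eq [] e isBase_one_two hv₀]
    rfl

/-- The second leaper is taken to be the (1, 2)-leaper. The base frame is then (2, 3) or (2, 5), and
offset zero lies in its shell; origin `f` would give (1, 4), which has no shell. -/
theorem exists_isSecondFundamentalCycle (e : List Lifting) (o : Lifting)
    (ho : o = Lifting.g ∨ o = Lifting.h) :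
    ∃ (V : Type u) (Ψ : LabeledDigraph V), IsSecondFundamentalCycle e o Ψ := by
  have hbase : IsBase (proportions [o]) 0 := by
    rcases ho with rfl | rfl <;> simp [IsBase, IsShellOffset, proportions, Lifting.frame]
  obtain ⟨C, hC, hv⟩ := exists_leaperCycle hbase e
  obtain ⟨C₀, hC₀, hv₀⟩ := exists_shellCycle hbase
  rw [← proportions_append] at hC
  obtain ⟨V, Ψ, hΨ⟩ := exists_isExtractedFrom (proportions []).1 (proportions []).2
    ((formalCycle e).map (evalSq (proportions [o]) 0))
  refine ⟨V, Ψ, _, _, C, _, _, _, isSkewBasic_proportions (e ++ [o]), ⟨hC, ?_⟩,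
    isSkewBasic_proportions [], ⟨[], rfl, rfl, C₀, _, hC₀, fun i => ⟨_, ?_, rfl⟩, ?_,
      (flatten_liftCycles [o] e 0).symm, ?_⟩, hΨ⟩
  · rw [hv, proportions_append]
    rintro a ⟨P, hP, rfl⟩
    exact evalSq_mem_board hbase hP
  · exact hbase.2.mem_frameSection i
  · rw [hv₀]
    ext a
    simp only [vertexSet, List.mem_flatten, Set.mem_ofPred_eq]
    constructor
    · rintro ⟨l, hl, ha⟩
      obtain ⟨i, rfl⟩ := List.mem_ofFn.1 hl
      exact ⟨i, List.mem_singleton.1 ha⟩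
    · rintro ⟨i, rfl⟩
      exact ⟨_, List.mem_ofFn.2 ⟨i, rfl⟩, List.mem_singleton.2 rfl⟩
  · rw [hv, vertexSet_map_evalSq]

/-! ### The fundamental direction cycles as positioned direction graphs -/

theorem exists_formal_positions {V : Type*} (h : IsBase x t) (e : List Lifting) {l : List Square}
    (hl : vertexSet l = {a | ∃ P ∈ formalCycle e, evalSq x t P = a}) (σ : {a // a ∈ l} ≃ V) :
    ∃ pos : V → Matrix (Fin 2) (Fin 2) ℤ, Function.Injective pos ∧
      Set.range pos = {P | P ∈ formalCycle e} ∧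
      ∀ v, evalSq x t (pos v) = (σ.symm v).1 := by
  have hex : ∀ v, ∃ P ∈ formalCycle e, evalSq x t P = (σ.symm v).1 := fun v =>
    (Set.ext_iff.1 hl _).1 (σ.symm v).2
  choose pos hmem hpos using hex
  refine ⟨pos, fun v w hvw => ?_, Set.eq_of_subset_of_subset ?_ ?_, hpos⟩
  · exact σ.symm.injective (Subtype.ext (by rw [← hpos, ← hpos, hvw]))
  · rintro _ ⟨v, rfl⟩
    exact hmem v
  · intro P hP
    have hP' : evalSq x t P ∈ vertexSet l := hl ▸ ⟨P, hP, rfl⟩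
    refine ⟨σ ⟨_, hP'⟩, evalSq_injOn h e (hmem _) hP ?_⟩
    rw [hpos, Equiv.symm_apply_apply]

theorem IsFundamentalCycle.exists_cycle {V : Type*} {e : List Lifting} {Φ : LabeledDigraph V}
    (hΦ : IsFundamentalCycle e Φ) : ∃ (x : ℤ × ℤ) (t : Square) (C : List Square), IsBase x t ∧
      IsLeaperCycle (act (wordMatrix e) x).1 (act (wordMatrix e) x).2 C ∧
      vertexSet C = {a | ∃ P ∈ formalCycle e, evalSq x t P = a} ∧
      IsExtractedFrom Φ (act (wordMatrix e) x).1 (act (wordMatrix e) x).2 C := by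
  obtain ⟨p, q, C, -, ⟨hC, -⟩, ⟨d, hpq, C₀, hC₀, hv⟩, hext⟩ := hΦ
  have hpos := proportions_pos d
  obtain ⟨t, ht, hv₀⟩ := hC₀.exists_offset hpos.1 hpos.2
  rw [proportions_append] at hpq
  refine ⟨proportions d, t, C, ⟨hpos, ht⟩, ?_, ?_, ?_⟩
  · rwa [hpq]
  · rw [hv, liftSets_eq d e ⟨hpos, ht⟩ hv₀]
  · rwa [hpq]

/-- A move between two values determines the formal difference because evaluation is injective on
the formal cycle. Conversely, a formal difference of this form is a move on the board, and all such
moves from a square of the cycle are edges of it. -/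
theorem IsLeaperCycle.isPositioned {V : Type*} {e : List Lifting} {Φ : LabeledDigraph V}
    {U : Matrix (Fin 2) (Fin 2) ℤ} (hU : wordMatrix e * U = 1) (hU' : U * wordMatrix e = 1)
    (h : IsBase x t) {C : List Square}
    (hC : IsLeaperCycle (act (wordMatrix e) x).1 (act (wordMatrix e) x).2 C)
    (hv : vertexSet C = {a | ∃ P ∈ formalCycle e, evalSq x t P = a})
    (hΦ : IsExtractedFrom Φ (act (wordMatrix e) x).1 (act (wordMatrix e) x).2 C) :
    ∃ pos : V → Matrix (Fin 2) (Fin 2) ℤ, Set.range pos = {P | P ∈ formalCycle e} ∧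
      Φ.IsPositioned pos U := by
  obtain ⟨σ, hσ⟩ := hΦ
  obtain ⟨pos, hinj, hrange, hpos⟩ := exists_formal_positions h e hv σ
  have hwm := act_wordMatrix_pos e h.1
  have hmem : ∀ v, pos v ∈ formalCycle e := fun v =>
    (Set.ext_iff.1 hrange _).1 (Set.mem_range_self v)
  refine ⟨pos, hrange, hinj, ⟨_, hU'⟩, fun v w k => ?_⟩
  have hF : ∀ a ∈ C, ∃ i, a ∈ frameSection (act (wordMatrix e) x).1 (act (wordMatrix e) x).2 i := by
    intro a ha
    obtain ⟨P, hP, rfl⟩ : a ∈ {a | ∃ P ∈ formalCycle e, evalSq x t P = a} := hv ▸ ha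
    obtain ⟨i, hi⟩ := mem_formalCycle.1 hP
    exact ⟨i, evalSq_mem_frameSection h hi⟩
  have harc := hσ (σ.symm v) (σ.symm w) k
  rw [Equiv.apply_symm_apply, Equiv.apply_symm_apply] at harc
  rw [harc]
  constructor
  · rintro ⟨-, hmove⟩
    rw [← hpos, ← hpos] at hmove
    obtain ⟨i, hi⟩ := mem_formalCycle.1 (hmem v)
    obtain ⟨j, -, hj⟩ := add_move_mem_formalPaths hi (moveDir_frameSection_board hwm.2
      (evalSq_mem_frameSection h hi) (evalSq_mem_board h (hmem w)) hmove)
    have hw : pos w = pos v + dirMatrix k * wordMatrix e := by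
      refine evalSq_injOn h e (hmem w) (mem_formalCycle_of_mem hj) ?_
      rw [evalSq_add, act_mul]
      exact moveDir_iff_act.1 hmove
    rw [hw, add_sub_cancel_left, Matrix.mul_assoc, hU, Matrix.mul_one]
  · intro hk
    have hw : pos w = pos v + dirMatrix k * wordMatrix e := by
      rw [← hk, Matrix.mul_assoc, hU', Matrix.mul_one, add_sub_cancel]
    have hmove : MoveDir (act (wordMatrix e) x).1 (act (wordMatrix e) x).2 k (σ.symm v).1
        (σ.symm w).1 := by
      rw [moveDir_iff_act, ← hpos, ← hpos, hw, evalSq_add, act_mul]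
    exact ⟨hC.follows_of_moveDir hwm.1 hwm.2 hF (σ.symm v).2
      (hpos w ▸ evalSq_mem_board h (hmem w)) hmove, hmove⟩

theorem IsSecondFundamentalCycle.exists_cycle {V : Type*} {e : List Lifting} {o : Lifting}
    {Ψ : LabeledDigraph V} (hΨ : IsSecondFundamentalCycle e o Ψ) :
    ∃ (y : ℤ × ℤ) (t : Square), (0 < y.1 ∧ y.1 < y.2) ∧ IsBase (act o.matrix y) t ∧
      IsExtractedFrom Ψ y.1 y.2 ((formalCycle e).map (evalSq (act o.matrix y) t)) := by
  obtain ⟨p, q, C, r, s, D, -, -, -, ⟨d, -, hrs, C₀, a₀, hC₀, ha₀, hv₀, hD, -⟩, hext⟩ := hΨ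
  have hpos := proportions_pos (o :: d)
  obtain ⟨t, ht, hv⟩ := hC₀.exists_offset hpos.1 hpos.2
  -- Each section contains exactly one square of the shell cycle, so the partition into eight paths
  -- is forced.
  have ha : a₀ = fun i => [octVec ((proportions (o :: d)).2 - (proportions (o :: d)).1)
      (proportions (o :: d)).1 i + t] := by
    funext i
    obtain ⟨z, hz, hzi⟩ := ha₀ i
    have hz' : z ∈ vertexSet C₀ := by
      rw [← hv₀]
      exact List.mem_flatten.2 ⟨a₀ i, List.mem_ofFn.2 ⟨i, rfl⟩, by simp [hzi]⟩
    rw [hv] at hz'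
    obtain ⟨j, hj⟩ := hz'
    rw [hj] at hz
    obtain rfl := frameSection_unique hpos.2 hz (ht.mem_frameSection j)
    rw [hzi, hj]
  have hx : proportions (o :: d) = act o.matrix (proportions d) := by
    rw [proportions, o.frame_eq_act]
  refine ⟨proportions d, t, proportions_pos d, ?_, ?_⟩
  · rw [← hx]
    exact ⟨hpos, ht⟩
  · rw [ha, flatten_liftCycles, hx] at hD
    rw [← hD, hrs]
    exact hext

/-- The inverse of A_g is `secondMat` and that of A_h is its image under a reflection, so one formal
second leaper serves both origins. -/
theorem secondMat_mul_matrix {o : Lifting} (ho : o = Lifting.g ∨ o = Lifting.h) :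
    (∃ k, secondMat * o.matrix = dirMatrix k) ∧
      ∃ V k, V = dirMatrix k * secondMat ∧ o.matrix * V = 1 := by
  rcases ho with rfl | rfl
  · exact ⟨by decide, secondMat, 1, by decide⟩
  · exact ⟨by decide, !![-2, 1; 1, 0], by decide⟩

theorem SecondMove.exists_moveDir {o : Lifting} (ho : o = Lifting.g ∨ o = Lifting.h)
    {P Q : Matrix (Fin 2) (Fin 2) ℤ} (h : SecondMove P Q) (y : ℤ × ℤ) (t : Square) :
    ∃ k, (Q - P) * o.matrix = dirMatrix k ∧
      MoveDir y.1 y.2 k (evalSq (act o.matrix y) t P) (evalSq (act o.matrix y) t Q) := by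
  obtain ⟨⟨k', hk'⟩, -⟩ := secondMat_mul_matrix ho
  obtain ⟨k, hk⟩ := h
  obtain ⟨k'', h''⟩ := exists_dirMatrix_mul k k'
  have h : (Q - P) * o.matrix = dirMatrix k'' := by
    rw [hk, Matrix.mul_assoc, hk', h'']
  refine ⟨k'', h, ?_⟩
  rw [moveDir_iff_act, ← h, act_mul, ← evalSq_add, add_sub_cancel]

/-- That a second move joins only consecutive formal squares does not involve `y`, so it is tested
at (1, 2), where it is the statement on common sides. -/
theorem isPositioned_second {V : Type*} {e : List Lifting} {o : Lifting} {Ψ : LabeledDigraph V}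
    (ho : o = Lifting.g ∨ o = Lifting.h) {y : ℤ × ℤ} (hy : 0 < y.1 ∧ y.1 < y.2)
    (h : IsBase (act o.matrix y) t)
    (hΨ : IsExtractedFrom Ψ y.1 y.2 ((formalCycle e).map (evalSq (act o.matrix y) t))) :
    ∃ pos : V → Matrix (Fin 2) (Fin 2) ℤ, Set.range pos = {P | P ∈ formalCycle e} ∧
      Ψ.IsPositioned pos o.matrix := by
  obtain ⟨σ, hσ⟩ := hΨ
  obtain ⟨pos, hinj, hrange, hpos⟩ := exists_formal_positions h e (vertexSet_map_evalSq _ _ e) σ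
  have hmem : ∀ v, pos v ∈ formalCycle e := fun v =>
    (Set.ext_iff.1 hrange _).1 (Set.mem_range_self v)
  obtain ⟨-, U, k₀, hU, hoU⟩ := secondMat_mul_matrix ho
  refine ⟨pos, hrange, hinj, ⟨U, hoU⟩, fun v w k => ?_⟩
  have harc := hσ (σ.symm v) (σ.symm w) k
  rw [Equiv.apply_symm_apply, Equiv.apply_symm_apply, ← hpos, ← hpos] at harc
  rw [harc]
  have hnext : ∀ {v w}, Follows ((formalCycle e).map (evalSq (act o.matrix y) t))
      (evalSq (act o.matrix y) t (pos v)) (evalSq (act o.matrix y) t (pos w)) →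
      SecondMove (pos v) (pos w) := by
    intro v w hvw
    obtain ⟨P, Q, hP, hQ, hPQ⟩ := CycNext.of_map hvw
    rw [← evalSq_injOn h e hPQ.mem_left (hmem v) hP, ← evalSq_injOn h e hPQ.mem_right (hmem w) hQ]
    exact hPQ.secondMove
  constructor
  · rintro ⟨hadj, hmove⟩
    have hvw : SecondMove (pos v) (pos w) := by
      rcases hadj with hadj | hadj
      exacts [hnext hadj, (hnext hadj).symm]
    obtain ⟨k', hk', hmove'⟩ := hvw.exists_moveDir ho y t
    rwa [hmove.dir_unique hy.1 hy.2 hmove']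
  · intro hk
    have hvw : SecondMove (pos v) (pos w) := by
      obtain ⟨k', hk'⟩ := exists_dirMatrix_mul k k₀
      refine ⟨k', ?_⟩
      rw [← hk', Matrix.mul_assoc, ← hU, ← hk, Matrix.mul_assoc, hoU, Matrix.mul_one]
    obtain ⟨i, hi⟩ := mem_formalCycle.1 (hmem v)
    obtain ⟨j, hj⟩ := mem_formalCycle.1 (hmem w)
    refine ⟨(areAdjacent_of_isNear hi hj hvw.isNear).cycNext.imp (·.map _) (·.map _), ?_⟩
    obtain ⟨k', hk', hmove⟩ := hvw.exists_moveDir ho y t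
    rwa [dirMatrix_injective (hk.symm.trans hk')]

theorem follows_secondCycle {e : List Lifting} {o : Lifting} (ho : o = Lifting.g ∨ o = Lifting.h)
    {y : ℤ × ℤ} {a b : Square}
    (hab : Follows ((formalCycle e).map (evalSq (act o.matrix y) t)) a b) :
    ∃ k, MoveDir y.1 y.2 k a b := by
  obtain ⟨P, Q, rfl, rfl, hPQ⟩ := CycNext.of_map hab
  obtain ⟨k, -, hk⟩ := hPQ.secondMove.exists_moveDir ho y t
  exact ⟨k, hk⟩

/-! ### The duality matrices -/

theorem lt_proportions_sum (c : Lifting) (e : List Lifting) :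
    3 < (proportions (c :: e)).1 + (proportions (c :: e)).2 := by
  have h := proportions_pos e
  rw [proportions]
  generalize proportions e = y at *
  obtain ⟨m, n⟩ := y
  cases c <;> simp only [Lifting.frame] at * <;> omega

/-- A direction matrix sends (1, 2) to a pair of sum at most 3, whereas this product sends it to the
proportions of a properly lifted frame, whose sum is larger. -/
theorem wordMatrix_mul_ne_dirMatrix (e : List Lifting) (o : Lifting) (k : Fin 8) :
    wordMatrix e * o.matrix ≠ dirMatrix k := by
  intro h
  have h1 : proportions (e ++ [o]) = act (dirMatrix k) (1, 2) := by
    rw [proportions_append, ← h, act_mul, proportions, o.frame_eq_act]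
    rfl
  have h2 : 3 < (proportions (e ++ [o])).1 + (proportions (e ++ [o])).2 := by
    cases e
    exacts [lt_proportions_sum _ _, lt_proportions_sum _ _]
  rw [h1] at h2
  revert h2
  clear h h1
  revert k
  decide

theorem mainTheorem8 (e : List Lifting) (o : Lifting) (ho : o = Lifting.g ∨ o = Lifting.h) :
    (∃ (V : Type u) (Φ : LabeledDigraph V), IsFundamentalCycle e Φ) ∧
    (∃ (V : Type u) (Ψ : LabeledDigraph V), IsSecondFundamentalCycle e o Ψ) ∧
    ∀ (V W : Type u) (Φ : LabeledDigraph V) (Ψ : LabeledDigraph W),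
      IsFundamentalCycle e Φ → IsSecondFundamentalCycle e o Ψ →
        Φ.IsDual ∧ Ψ.IsDual ∧
        Ψ.IsDualWith Φ (realMatrix (wordMatrix e * o.matrix)) ∧
        Φ.IsDualWith Ψ (realMatrix (wordMatrix e * o.matrix))⁻¹ := by
  refine ⟨exists_isFundamentalCycle e, exists_isSecondFundamentalCycle e o ho,
    fun V W Φ Ψ hΦ hΨ => ?_⟩
  obtain ⟨x, t, C, hx, hC, hv, hΦC⟩ := hΦ.exists_cycle
  obtain ⟨y, t', hy, hoy, hΨD⟩ := hΨ.exists_cycle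
  obtain ⟨U, hU, hU'⟩ := exists_wordMatrix_inverse e
  obtain ⟨-, U₀, -, -, hU₀⟩ := secondMat_mul_matrix ho
  obtain ⟨pos, hrange, hpos⟩ := hC.isPositioned hU hU' hx hv hΦC
  obtain ⟨pos', hrange', hpos'⟩ := isPositioned_second ho hy hoy hΨD
  have hnd := nodup_map_evalSq hoy e
  have hlen : C.length = ((formalCycle e).map (evalSq (act o.matrix y) t')).length := by
    rw [vertexSet_length_eq hC.1 (nodup_map_evalSq hx e)
      (hv.trans (vertexSet_map_evalSq _ _ _).symm), List.length_map, List.length_map]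
  have h3 := three_le_length_formalCycle e
  have hmoves : ∀ a b, Follows ((formalCycle e).map (evalSq (act o.matrix y) t')) a b →
    ∃ k, MoveDir y.1 y.2 k a b := fun a b => follows_secondCycle ho
  have hΦconn := isConnected_of_isExtractedFrom hΦC (le_trans (by norm_num) hC.2.1) hC.2.2
  have hΨconn := isConnected_of_isExtractedFrom hΨD (by rw [List.length_map]; omega) hmoves
  have hinv : wordMatrix e * o.matrix * (U₀ * U) = 1 := by
    rw [Matrix.mul_assoc, ← Matrix.mul_assoc o.matrix, hU₀, Matrix.one_mul, hU]
  have hrinv : (realMatrix (wordMatrix e * o.matrix))⁻¹ = realMatrix (U₀ * U) :=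
    Matrix.inv_eq_right_inv (by rw [← realMatrix_mul, hinv, realMatrix_one])
  -- Distances in `Ψ` are differences times A_o, those in `Φ` differences times the inverse of A_e;
  -- the quotient is A_e A_o.
  have h₁ : Ψ.IsDualWith Φ (realMatrix (wordMatrix e * o.matrix)) := by
    refine hpos'.isDualWith hpos ?_ (fun k hk => ?_) hΨconn hΦconn (hrange'.trans hrange.symm)
      (exists_iso_of_isExtractedFrom hΨD hΦC hnd hC.1 hmoves hC.2.2 hlen.symm)
    · rw [← realMatrix_mul, ← Matrix.mul_assoc, hU', Matrix.one_mul]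
    · exact wordMatrix_mul_ne_dirMatrix e o k (realMatrix_injective hk)
  have h₂ : Φ.IsDualWith Ψ (realMatrix (wordMatrix e * o.matrix))⁻¹ := by
    refine hpos.isDualWith hpos' ?_ (fun k hk => ?_) hΦconn hΨconn (hrange.trans hrange'.symm)
      (exists_iso_of_isExtractedFrom hΦC hΨD hC.1 hnd hC.2.2 hmoves hlen)
    · rw [hrinv, ← realMatrix_mul, ← Matrix.mul_assoc, hU₀, Matrix.one_mul]
    -- Direction matrices form a group: if the inverse were one, the product A_e A_o would be one
    -- too.
    · obtain ⟨k', hk'⟩ := exists_dirMatrix_mul_eq_one k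
      rw [hrinv] at hk
      rw [realMatrix_injective hk] at hinv
      refine wordMatrix_mul_ne_dirMatrix e o k' ?_
      rw [← Matrix.mul_one (wordMatrix e * o.matrix), ← hk', ← Matrix.mul_assoc, hinv,
        Matrix.one_mul]
  exact ⟨⟨_, _, _, h₂⟩, ⟨_, _, _, h₁⟩, h₁, h₂⟩
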